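/- A graph $G=(V,E)$ is \emph{distance hereditary} if for every pair of nonadjacent vertices $x,y$ and every connected induced subgraph $H$ of $G$ that contains $x$ and $y$, the distance between $x$ and $y$ in $H$ equals their distance in $G$. The \emph{black-and-white coloring problem} asks, given a finite simple graph $G$ and integers $b,w\ge 0$, whether there exist disjoint sets of vertices $B$ and $W$ with $|B|=b$ and $|W|=w$ such that no vertex of $B$ is adjacent to any vertex of $W$. \textbf{Theorem.} There exists a polynomial-time algorithm that solves the black-and-white coloring problem on distance-hereditary graphs; more precisely, it runs in $O(n^{13})$ time, where $n$ is the number of vertices of $G$. Here the model is the unit-cost random access machine (word RAM): there are one fixed program and a constant $k$ such that, for every distance-hereditary graph $G$ with vertex set $\{0,\dots,n-1\}$ (given by its adjacency matrix) and all integers $b,w\ge 0$, the program halts with the correct answer after at most $T(n)$ steps, where $T(n)=O(n^{13})$ does not depend on $G$, $b$, $w$, and it only uses numbers that are at most $(n+b+w+2)^k$. -/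

import Mathlib

namespace BWColoring

/-- `G` is distance hereditary: for every pair of nonadjacent vertices `x`, `y` and every connected
induced subgraph `G[S]` containing both, the distance between `x` and `y` in `G[S]` is the same
as in `G`. -/
def IsDistanceHereditary {V : Type*} (G : SimpleGraph V) : Prop :=
  ∀ x y : V, ¬ G.Adj x y → ∀ (S : Set V) (hx : x ∈ S) (hy : y ∈ S),
    (G.induce S).Connected → (G.induce S).dist ⟨x, hx⟩ ⟨y, hy⟩ = G.dist x y

/-- `G` has a black-and-white coloring with `b` black and `w` white vertices. -/
def HasColoring {V : Type*} (G : SimpleGraph V) (b w : ℕ) : Prop :=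
  ∃ B W : Finset V, Disjoint B W ∧ B.card = b ∧ W.card = w ∧
    ∀ x ∈ B, ∀ y ∈ W, ¬ G.Adj x y

/-- Programs of a random access machine with registers `0, 1, 2, …` (a program names only
finitely many of them) and a separate random access memory. All contents are natural numbers. -/
inductive Prog : Type
  /-- do nothing -/
  | skip : Prog
  /-- `reg r := k` -/
  | const (r k : ℕ) : Prog
  /-- `reg r := reg s` -/
  | copy (r s : ℕ) : Prog
  /-- `reg r := reg s + reg t` -/
  | add (r s t : ℕ) : Prog
  /-- `reg r := reg s - reg t`, or `0` if this is negative -/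
  | sub (r s t : ℕ) : Prog
  /-- `reg r := reg s * reg t` -/
  | mul (r s t : ℕ) : Prog
  /-- `reg r := mem (reg a)` -/
  | load (r a : ℕ) : Prog
  /-- `mem (reg a) := reg r` -/
  | store (a r : ℕ) : Prog
  /-- first `c`, then `d` -/
  | seq (c d : Prog) : Prog
  /-- if `reg r < reg s` then `c` else `d` -/
  | ifLt (r s : ℕ) (c d : Prog) : Prog
  /-- while `reg r < reg s` do `c` -/
  | whileLt (r s : ℕ) (c : Prog) : Prog

/-- Contents of the registers and of the memory. -/
structure State where
  reg : ℕ → ℕ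
  mem : ℕ → ℕ

/-- The state after writing `v` into register `r`. -/
def State.setReg (σ : State) (r v : ℕ) : State :=
  { σ with reg := Function.update σ.reg r v }

/-- The state after writing `v` into memory cell `a`. -/
def State.setMem (σ : State) (a v : ℕ) : State :=
  { σ with mem := Function.update σ.mem a v }

/-- `Exec M c σ t τ`: started in state `σ`, the program `c` halts in state `τ` after exactly `t`
steps, and no number larger than `M` is ever written. Every basic instruction and every evaluation
of the test of a conditional or of a loop takes one step. There is no rule for writing a number
larger than `M`, so `M` is the largest number that fits into a machine word. -/
inductive Exec (M : ℕ) : Prog → State → ℕ → State → Prop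
  | skip (σ : State) : Exec M .skip σ 1 σ
  | const (σ : State) (r k : ℕ) (h : k ≤ M) : Exec M (.const r k) σ 1 (σ.setReg r k)
  | copy (σ : State) (r s : ℕ) (h : σ.reg s ≤ M) :
      Exec M (.copy r s) σ 1 (σ.setReg r (σ.reg s))
  | add (σ : State) (r s t : ℕ) (h : σ.reg s + σ.reg t ≤ M) :
      Exec M (.add r s t) σ 1 (σ.setReg r (σ.reg s + σ.reg t))
  | sub (σ : State) (r s t : ℕ) (h : σ.reg s - σ.reg t ≤ M) :
      Exec M (.sub r s t) σ 1 (σ.setReg r (σ.reg s - σ.reg t))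
  | mul (σ : State) (r s t : ℕ) (h : σ.reg s * σ.reg t ≤ M) :
      Exec M (.mul r s t) σ 1 (σ.setReg r (σ.reg s * σ.reg t))
  | load (σ : State) (r a : ℕ) (h : σ.mem (σ.reg a) ≤ M) :
      Exec M (.load r a) σ 1 (σ.setReg r (σ.mem (σ.reg a)))
  | store (σ : State) (a r : ℕ) (h : σ.reg r ≤ M) :
      Exec M (.store a r) σ 1 (σ.setMem (σ.reg a) (σ.reg r))
  | seq {c d : Prog} {σ τ υ : State} {t u : ℕ} :
      Exec M c σ t τ → Exec M d τ u υ → Exec M (.seq c d) σ (t + u) υ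
  | ifTrue {r s : ℕ} {c d : Prog} {σ τ : State} {t : ℕ} :
      σ.reg r < σ.reg s → Exec M c σ t τ → Exec M (.ifLt r s c d) σ (t + 1) τ
  | ifFalse {r s : ℕ} {c d : Prog} {σ τ : State} {t : ℕ} :
      ¬ σ.reg r < σ.reg s → Exec M d σ t τ → Exec M (.ifLt r s c d) σ (t + 1) τ
  | whileTrue {r s : ℕ} {c : Prog} {σ τ υ : State} {t u : ℕ} :
      σ.reg r < σ.reg s → Exec M c σ t τ → Exec M (.whileLt r s c) τ u υ →
      Exec M (.whileLt r s c) σ (t + u + 1) υ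
  | whileFalse {r s : ℕ} {c : Prog} {σ : State} :
      ¬ σ.reg r < σ.reg s → Exec M (.whileLt r s c) σ 1 σ

open Classical in
/-- The initial state for the instance `(G, b, w)`: registers `0, 1, 2` hold `n, b, w`, the memory
cells `0, …, n * n - 1` hold the adjacency matrix of `G` row by row, and everything else is `0`. -/
noncomputable def input {n : ℕ} (G : SimpleGraph (Fin n)) (b w : ℕ) : State where
  reg r := if r = 0 then n else if r = 1 then b else if r = 2 then w else 0
  mem a := if ∃ i j : Fin n, G.Adj i j ∧ a = (i : ℕ) * n + (j : ℕ) then 1 else 0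

/-- In state `τ` the output register `0` holds the truth value of `P`
(`1` for true, `0` for false). -/
def Answers (τ : State) (P : Prop) : Prop :=
  (P → τ.reg 0 = 1) ∧ (¬ P → τ.reg 0 = 0)

end BWColoring

/-!
A distance-hereditary graph can be dismantled vertex by vertex: every set of at least two vertices
contains a *pruning pair* `i`, `j`, which means that `i` and `j` are twins within the set, or that
`j` has no neighbour in the set except possibly `i`
(`CommonNeighborOnWalks.exists_isPruningPair`). For the proof only one consequence of distance
heredity is used, which passes to induced subgraphs: two nonadjacent vertices with a common
neighbour have a common neighbour on every walk that joins them. It excludes an induced path on four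
vertices whose ends have a common neighbour. Now arrange a connected graph in levels by the distance
from a root. Adjacent vertices of one level have the same neighbours in the level below, two lower
neighbours of a vertex have the same neighbours below them, and the lower neighbourhoods of the
vertices of one level are disjoint or nested (`IsLeveling.lower_of_adj`,
`IsLeveling.lower_of_common_upper`, `IsLeveling.laminar`). Take a vertex of the
last level with fewest lower neighbours. Either other vertices of that level have the same lower
neighbours, or it is pendant, or its neighbourhood has at least two elements. In the first and the
last case there is a set of at least two vertices that no outside vertex distinguishes and that
induces a `P₄`-free graph; such a graph has twins by Seinsche's theorem.

The algorithm merges the two vertices of a pruning pair until one vertex is left. Each remaining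
vertex `i` stands for a cluster `C i` of vertices with a boundary, which contains all ends of edges
that leave the cluster, and two adjacent representatives have completely adjacent boundaries
(`IsClustering.merge`). Therefore all that matters about a coloring of a cluster are four numbers:
how many black and white vertices there are in the boundary and in the whole cluster. For each
cluster a table lists the possible quadruples. The table of a union consists of the sums of
compatible entries (`clusterColoring_union`), and the table of the last cluster contains the answer.

The program is written in a small structured language with expressions and bounded loops, for which
a compiler to the random access machine is verified (`Cmd.exec_compile`). Programs of this language
have a total semantics, so that their correctness is a matter of weakest preconditions
(`Cmd.wp_loop`, `Cmd.wp_nest`), and their running time is bounded by a constant times `(n + 1) ^ d`,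
where `d` is the depth of the nesting of loops (`Prog.cost_le`). Merging takes eight nested loops
inside the loop over the rounds, so `d = 9`. A number computed by an expression of size `s` from
numbers at most `X` is at most `X ^ s` (`Expr.eval_le`), which keeps everything polynomial.
-/

namespace BWColoring

/-! ### Cographs have twins -/

/-- `G` has no induced path on four vertices inside `S`. (Distinctness of `a, b, c, d` follows from
the six conditions.) -/
def P4FreeOn {V : Type*} (G : SimpleGraph V) (S : Finset V) : Prop :=
  ∀ a ∈ S, ∀ b ∈ S, ∀ c ∈ S, ∀ d ∈ S, G.Adj a b → G.Adj b c → G.Adj c d →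
    ¬ G.Adj a c → ¬ G.Adj b d → G.Adj a d

/-- `S` falls into two nonempty parts without edges between them. -/
def SplitsOn {V : Type*} (G : SimpleGraph V) (S : Finset V) : Prop :=
  ∃ A B : Set V, A.Nonempty ∧ B.Nonempty ∧ A ∪ B = S ∧ Disjoint A B ∧
    ∀ a ∈ A, ∀ b ∈ B, ¬ G.Adj a b

theorem P4FreeOn.compl {V : Type*} {G : SimpleGraph V} {S : Finset V} (h : P4FreeOn G S) :
    P4FreeOn Gᶜ S := by
  intro a ha b hb c hc d hd hab hbc hcd hac hbd
  rw [SimpleGraph.compl_adj] at *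
  have hne : a ≠ d := by
    rintro rfl
    exact hac ⟨hcd.1.symm, fun h => hcd.2 h.symm⟩
  refine ⟨hne, fun had => ?_⟩
  have hac' : G.Adj a c := by
    by_contra hn
    refine hac ⟨?_, hn⟩
    rintro rfl
    exact hcd.2 had
  have hbd' : G.Adj b d := by
    by_contra hn
    refine hbd ⟨?_, hn⟩
    rintro rfl
    exact hab.2 had
  exact hbc.2 (h c hc a ha d hd b hb hac'.symm had hbd'.symm hcd.2 hab.2).symm

/-- Adding a vertex `v` to a set that splits: either `v` is adjacent to everything, or it misses
one of the two parts, or the non-neighbours of `v` in one of the parts split off. -/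
theorem SplitsOn.insert {V : Type*} [DecidableEq V] {G : SimpleGraph V} {S : Finset V} {v : V}
    (hv : v ∉ S) (hP : P4FreeOn G (insert v S)) (h : SplitsOn G S) :
    SplitsOn G (insert v S) ∨ SplitsOn Gᶜ (insert v S) := by
  obtain ⟨A, B, hA, hB, hAB, hdis, hadj⟩ := h
  have hS : ∀ x, x ∈ S ↔ x ∈ A ∨ x ∈ B := fun x => by
    rw [← Finset.mem_coe, ← hAB]; rfl
  by_cases huniv : ∀ x ∈ S, G.Adj v x
  · right
    obtain ⟨a, ha⟩ := hA
    refine ⟨{v}, S, ⟨v, rfl⟩, ⟨a, (hS a).2 (Or.inl ha)⟩, by simp, by simpa using hv, ?_⟩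
    rintro _ rfl b hb hn
    exact ((SimpleGraph.compl_adj _ _ _).1 hn).2 (huniv b hb)
  left
  push Not at huniv
  obtain ⟨x, hx, hvx⟩ := huniv
  -- By symmetry the non-neighbour `x` of `v` may be taken in the first part.
  have key : ∀ A B : Set V, A ∪ B = S → Disjoint A B → (∀ a ∈ A, ∀ b ∈ B, ¬ G.Adj a b) →
      B.Nonempty → x ∈ A → SplitsOn G (Insert.insert v S) := by
    intro A B hAB hdis hadj hB hxA
    have hS : ∀ x, x ∈ S ↔ x ∈ A ∨ x ∈ B := fun x => by
      rw [← Finset.mem_coe, ← hAB]; rfl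
    have hvA : v ∉ A := fun h => hv ((hS v).2 (Or.inl h))
    have hvB : v ∉ B := fun h => hv ((hS v).2 (Or.inr h))
    by_cases hc : ∃ c ∈ B, G.Adj v c
    · obtain ⟨c, hcB, hvc⟩ := hc
      refine ⟨{a ∈ A | ¬ G.Adj v a}, {y | y = v ∨ y ∈ B ∨ (y ∈ A ∧ G.Adj v y)}, ⟨x, hxA, hvx⟩,
        ⟨v, Or.inl rfl⟩, ?_, ?_, ?_⟩
      · ext y
        simp only [Set.mem_union, Set.mem_ofPred_eq, Finset.coe_insert, Set.mem_insert_iff,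
          Finset.mem_coe, hS]
        tauto
      · rw [Set.disjoint_left]
        rintro y ⟨hyA, hy⟩ (rfl | hyB | ⟨-, hy'⟩)
        · exact hvA hyA
        · exact Set.disjoint_left.1 hdis hyA hyB
        · exact hy hy'
      · rintro a ⟨haA, ha⟩ y (rfl | hyB | ⟨hyA, hy⟩) hay
        · exact ha hay.symm
        · exact hadj a haA y hyB hay
        · refine hadj a haA c hcB (hP a ?_ y ?_ v ?_ c ?_ hay hy.symm hvc ?_ ?_)
          · simp [hS, haA]
          · simp [hS, hyA]
          · simp
          · simp [hS, hcB]
          · exact fun h => ha h.symm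
          · exact hadj y hyA c hcB
    · push Not at hc
      refine ⟨Insert.insert v A, B, ⟨v, by simp⟩, hB, ?_, ?_, ?_⟩
      · rw [Set.insert_union, hAB, Finset.coe_insert]
      · rw [Set.disjoint_left]
        rintro y (rfl | hyA) hyB
        · exact hvB hyB
        · exact Set.disjoint_left.1 hdis hyA hyB
      · rintro y (rfl | hyA) b hb
        · exact hc b hb
        · exact hadj y hyA b hb
  rcases (hS x).1 hx with hxA | hxB
  · exact key A B hAB hdis hadj hB hxA
  · exact key B A (by rw [Set.union_comm, hAB]) hdis.symm
      (fun b hb a ha h => hadj a ha b hb h.symm) hA hxB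

/-- Seinsche's theorem: a `P₄`-free graph with at least two vertices is disconnected or has a
disconnected complement. -/
theorem P4FreeOn.splitsOn {V : Type*} {G : SimpleGraph V} (S : Finset V)
    (hP : P4FreeOn G S) (hS : 2 ≤ S.card) : SplitsOn G S ∨ SplitsOn Gᶜ S := by
  classical
  induction S using Finset.induction_on with
  | empty => simp at hS
  | insert v S hv ih =>
    have hP' : P4FreeOn G S := fun a ha b hb c hc d hd =>
      hP a (by simp [ha]) b (by simp [hb]) c (by simp [hc]) d (by simp [hd])
    rw [Finset.card_insert_of_notMem hv] at hS
    by_cases h2 : 2 ≤ S.card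
    · rcases ih hP' h2 with h | h
      · exact h.insert hv hP
      · have := h.insert hv hP.compl
        rwa [compl_compl, or_comm] at this
    · obtain ⟨a, rfl⟩ := Finset.card_eq_one.1 (by omega : S.card = 1)
      have hva : v ≠ a := by simpa using hv
      by_cases hadj : G.Adj v a
      · right
        exact ⟨{v}, {a}, ⟨v, rfl⟩, ⟨a, rfl⟩, by simp [Set.pair_comm a v],
          by simpa using hva, by rintro _ rfl _ rfl; simp [hadj]⟩
      · left
        exact ⟨{v}, {a}, ⟨v, rfl⟩, ⟨a, rfl⟩, by simp [Set.pair_comm a v],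
          by simpa using hva, by rintro _ rfl _ rfl; exact hadj⟩

/-- A `P₄`-free set of at least two vertices contains twins: pass to a part of size at least two of
a splitting until only two vertices are left. -/
theorem P4FreeOn.exists_twins {V : Type*} {G : SimpleGraph V} (S : Finset V)
    (hP : P4FreeOn G S) (hS : 2 ≤ S.card) :
    ∃ i ∈ S, ∃ j ∈ S, i ≠ j ∧ ∀ k ∈ S, k ≠ i → k ≠ j → (G.Adj i k ↔ G.Adj j k) := by
  classical
  induction hc : S.card using Nat.strong_induction_on generalizing S with
  | _ m ih =>
  have key : ∀ A B : Set V, A.Nonempty → B.Nonempty → A ∪ B = S → Disjoint A B →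
      (∀ a ∈ A, ∀ a' ∈ A, ∀ b ∈ B, G.Adj a b ↔ G.Adj a' b) → A.Nontrivial →
      ∃ i ∈ S, ∃ j ∈ S, i ≠ j ∧ ∀ k ∈ S, k ≠ i → k ≠ j → (G.Adj i k ↔ G.Adj j k) := by
    intro A B hA hB hAB hdis hadj h2
    have hsub : ∀ x, x ∈ S.filter (· ∈ A) ↔ x ∈ A := fun x => by
      have : x ∈ A → x ∈ S := fun h => by
        rw [← Finset.mem_coe, ← hAB]; exact Or.inl h
      simp only [Finset.mem_filter]
      tauto
    obtain ⟨b, hb⟩ := hB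
    have hlt : (S.filter (· ∈ A)).card < S.card := by
      refine Finset.card_lt_card ⟨Finset.filter_subset _ _, fun h => ?_⟩
      have hbS : b ∈ S := by rw [← Finset.mem_coe, ← hAB]; exact Or.inr hb
      exact Set.disjoint_left.1 hdis ((hsub b).1 (h hbS)) hb
    have h2' : 2 ≤ (S.filter (· ∈ A)).card := by
      obtain ⟨x, hx, y, hy, hxy⟩ := h2
      exact Finset.one_lt_card.2 ⟨x, (hsub x).2 hx, y, (hsub y).2 hy, hxy⟩
    obtain ⟨i, hi, j, hj, hij, h⟩ := ih _ (hc ▸ hlt) (S.filter (· ∈ A))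
      (fun a ha b hb c hc d hd => hP a (Finset.mem_filter.1 ha).1 b (Finset.mem_filter.1 hb).1
        c (Finset.mem_filter.1 hc).1 d (Finset.mem_filter.1 hd).1) h2' rfl
    refine ⟨i, (Finset.mem_filter.1 hi).1, j, (Finset.mem_filter.1 hj).1, hij,
      fun k hk hki hkj => ?_⟩
    rw [← Finset.mem_coe, ← hAB] at hk
    rcases hk with hk | hk
    · exact h k ((hsub k).2 hk) hki hkj
    · exact hadj i ((hsub i).1 hi) j ((hsub j).1 hj) k hk
  have main : ∀ A B : Set V, A.Nonempty → B.Nonempty → A ∪ B = S → Disjoint A B →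
      (∀ a ∈ A, ∀ a' ∈ A, ∀ b ∈ B, ∀ b' ∈ B, G.Adj a b ↔ G.Adj a' b') →
      ∃ i ∈ S, ∃ j ∈ S, i ≠ j ∧ ∀ k ∈ S, k ≠ i → k ≠ j → (G.Adj i k ↔ G.Adj j k) := by
    intro A B hA hB hAB hdis hadj
    by_cases h1 : A.Nontrivial
    · exact key A B hA hB hAB hdis (fun a ha a' ha' b hb => hadj a ha a' ha' b hb b hb) h1
    by_cases h2 : B.Nontrivial
    · exact key B A hB hA (by rw [Set.union_comm, hAB]) hdis.symm
        (fun a ha a' ha' b hb => by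
          rw [G.adj_comm, G.adj_comm a']; exact hadj b hb b hb a ha a' ha') h2
    rw [Set.not_nontrivial_iff] at h1 h2
    obtain ⟨a, ha⟩ := hA
    obtain ⟨b, hb⟩ := hB
    have hmem : ∀ x, x ∈ S ↔ x ∈ A ∨ x ∈ B := fun x => by
      rw [← Finset.mem_coe, ← hAB]; rfl
    refine ⟨a, (hmem a).2 (Or.inl ha), b, (hmem b).2 (Or.inr hb), ?_, ?_⟩
    · rintro rfl
      exact Set.disjoint_left.1 hdis ha hb
    · intro k hk hka hkb
      rcases (hmem k).1 hk with hk | hk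
      · exact absurd (h1 hk ha) hka
      · exact absurd (h2 hk hb) hkb
  rcases hP.splitsOn S hS with ⟨A, B, hA, hB, hAB, hdis, hadj⟩ | ⟨A, B, hA, hB, hAB, hdis, hadj⟩
  · exact main A B hA hB hAB hdis fun a ha a' ha' b hb b' hb' =>
      iff_of_false (hadj a ha b hb) (hadj a' ha' b' hb')
  · have hadj' : ∀ a ∈ A, ∀ b ∈ B, G.Adj a b := fun a ha b hb => by
      by_contra hn
      refine hadj a ha b hb ((SimpleGraph.compl_adj _ _ _).2 ⟨?_, hn⟩)
      rintro rfl
      exact Set.disjoint_left.1 hdis ha hb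
    exact main A B hA hB hAB hdis fun a ha a' ha' b hb b' hb' =>
      iff_of_true (hadj' a ha b hb) (hadj' a' ha' b' hb')

/-! ### Pruning distance-hereditary graphs -/

/-- Two nonadjacent vertices `x`, `y` with a common neighbour have a common neighbour on every walk
that joins them. This weakening of distance heredity passes to induced subgraphs at once. -/
def CommonNeighborOnWalks {V : Type*} (G : SimpleGraph V) : Prop :=
  ∀ ⦃x y e : V⦄, x ≠ y → ¬ G.Adj x y → G.Adj x e → G.Adj e y →
    ∀ p : G.Walk x y, ∃ u ∈ p.support, G.Adj x u ∧ G.Adj u y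

theorem IsDistanceHereditary.commonNeighborOnWalks {V : Type*} {G : SimpleGraph V}
    (h : IsDistanceHereditary G) : CommonNeighborOnWalks G := by
  intro x y e hne hadj hxe hey p
  have hconn := p.connected_induce_support
  have hle : G.dist x y ≤ 2 := by
    simpa using G.dist_le (SimpleGraph.Walk.cons hxe (SimpleGraph.Walk.cons hey .nil))
  have hd := h x y hadj _ p.start_mem_support p.end_mem_support hconn
  obtain ⟨q, hq⟩ := hconn.exists_walk_length_eq_dist
    ⟨x, p.start_mem_support⟩ ⟨y, p.end_mem_support⟩
  rw [← hq] at hd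
  rw [← hd] at hle
  match q, hle with
  | .nil, _ => exact absurd rfl hne
  | .cons h1 .nil, _ => exact absurd h1 hadj
  | .cons (v := u) h1 (.cons h2 .nil), _ => exact ⟨u, u.2, h1, h2⟩
  | .cons _ (.cons _ (.cons _ _)), hle => simp at hle

theorem CommonNeighborOnWalks.induce {V : Type*} {G : SimpleGraph V}
    (h : CommonNeighborOnWalks G) (S : Set V) : CommonNeighborOnWalks (G.induce S) := by
  intro x y e hne hadj hxe hey p
  let f : G.induce S →g G := (SimpleGraph.Embedding.induce S).toHom
  obtain ⟨u, hu, h1, h2⟩ := h (x := f x) (y := f y) (e := f e) (fun h => hne (Subtype.ext h)) hadj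
    hxe hey (p.map f)
  rw [SimpleGraph.Walk.support_map, List.mem_map] at hu
  obtain ⟨u, hu, rfl⟩ := hu
  exact ⟨u, hu, h1, h2⟩

/-- No vertex is adjacent to both ends of an induced path on four vertices. -/
theorem CommonNeighborOnWalks.p4 {V : Type*} {G : SimpleGraph V}
    (h : CommonNeighborOnWalks G) {a b c d e : V} (hab : G.Adj a b) (hbc : G.Adj b c)
    (hcd : G.Adj c d) (hac : ¬ G.Adj a c) (hbd : ¬ G.Adj b d) (hae : G.Adj a e)
    (hed : G.Adj e d) : G.Adj a d := by
  by_contra had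
  have hne : a ≠ d := by rintro rfl; exact hac hcd.symm
  obtain ⟨u, hu, h1, h2⟩ := h hne had hae hed (.cons hab (.cons hbc (.cons hcd .nil)))
  simp only [SimpleGraph.Walk.support_cons, SimpleGraph.Walk.support_nil, List.mem_cons,
    List.not_mem_nil, or_false] at hu
  rcases hu with rfl | rfl | rfl | rfl
  · exact G.irrefl h1
  · exact hbd h2
  · exact hac h1
  · exact G.irrefl h2

/-- `d` behaves like the distance from the root `v`. -/
structure IsLeveling {V : Type*} (G : SimpleGraph V) (v : V) (d : V → ℕ) : Prop where
  eq_root : ∀ x, d x = 0 → x = v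
  le_succ : ∀ x y, G.Adj x y → d x ≤ d y + 1
  exists_lower : ∀ x, d x ≠ 0 → ∃ y, G.Adj y x ∧ d y + 1 = d x

theorem isLeveling_dist {V : Type*} {G : SimpleGraph V} (hG : G.Connected) (v : V) :
    IsLeveling G v (G.dist v) where
  eq_root x hx := ((hG v x).dist_eq_zero_iff.1 hx).symm
  le_succ x y hxy := by
    have := hG.dist_triangle (u := v) (v := y) (w := x)
    rwa [SimpleGraph.dist_eq_one_iff_adj.2 hxy.symm] at this
  exists_lower x hx := by
    obtain ⟨p, hp⟩ := hG.exists_walk_length_eq_dist x v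
    cases p with
    | nil => simp at hx
    | cons h q =>
      rename_i y
      refine ⟨y, h.symm, ?_⟩
      have h1 := G.dist_le q.reverse
      have h2 := hG.dist_triangle (u := v) (v := y) (w := x)
      rw [SimpleGraph.dist_eq_one_iff_adj.2 h.symm] at h2
      rw [G.dist_comm] at hp
      simp only [SimpleGraph.Walk.length_cons, SimpleGraph.Walk.length_reverse] at hp h1
      omega

namespace IsLeveling

variable {V : Type*} {G : SimpleGraph V} {v : V} {d : V → ℕ}

theorem exists_walk (hd : IsLeveling G v d) (x : V) :
    ∃ p : G.Walk x v, ∀ u ∈ p.support, u = x ∨ d u < d x := by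
  induction hk : d x generalizing x with
  | zero =>
    obtain rfl := hd.eq_root x hk
    exact ⟨.nil, by simp⟩
  | succ k ih =>
    obtain ⟨y, hy, hyx⟩ := hd.exists_lower x (by omega)
    obtain ⟨p, hp⟩ := ih y (by omega)
    refine ⟨.cons hy.symm p, fun u hu => ?_⟩
    rw [SimpleGraph.Walk.support_cons, List.mem_cons] at hu
    rcases hu with rfl | hu
    · exact Or.inl rfl
    · rcases hp u hu with rfl | h <;> right <;> omega

/-- Two nonadjacent vertices at distance two have a common neighbour strictly below one of them:
look for it on the walk that goes down to the root and up again. -/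
theorem exists_common_below (hd : IsLeveling G v d) (h : CommonNeighborOnWalks G) {x y e : V}
    (hne : x ≠ y) (hxy : ¬ G.Adj x y) (hxe : G.Adj x e) (hey : G.Adj e y) :
    ∃ u, G.Adj x u ∧ G.Adj u y ∧ (d u < d x ∨ d u < d y) := by
  obtain ⟨p, hp⟩ := hd.exists_walk x
  obtain ⟨q, hq⟩ := hd.exists_walk y
  obtain ⟨u, hu, h1, h2⟩ := h hne hxy hxe hey (p.append q.reverse)
  refine ⟨u, h1, h2, ?_⟩
  rw [SimpleGraph.Walk.mem_support_append_iff, SimpleGraph.Walk.support_reverse,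
    List.mem_reverse] at hu
  rcases hu with hu | hu
  · rcases hp u hu with rfl | h
    · exact absurd h1 (G.irrefl)
    · exact Or.inl h
  · rcases hq u hu with rfl | h
    · exact absurd h2 (G.irrefl)
    · exact Or.inr h

/-- Adjacent vertices of the same level have the same neighbours in the level below. -/
theorem lower_of_adj (hd : IsLeveling G v d) (h : CommonNeighborOnWalks G) {x y z : V}
    (hxy : G.Adj x y) (hdxy : d x = d y) (hz : d z + 1 = d x) (hxz : G.Adj x z) :
    G.Adj y z := by
  induction hk : d z generalizing x y z with
  | zero =>
    obtain ⟨y', hy', hd'⟩ := hd.exists_lower y (by omega)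
    rw [hd.eq_root z hk, ← hd.eq_root y' (by omega)]
    exact hy'.symm
  | succ k ih =>
    by_contra hyz
    obtain ⟨u, h1, h2, h3⟩ := hd.exists_common_below h (x := z) (y := y) (e := x)
      (by rintro rfl; omega) (fun h => hyz h.symm) hxz.symm hxy
    have := hd.le_succ y u h2.symm
    obtain ⟨w, hw, hdw⟩ := hd.exists_lower z (by omega)
    have huw : G.Adj u w := ih h1 (by omega) (by omega) hw.symm (by omega)
    have hwx : ¬ G.Adj w x := fun hn => by have := hd.le_succ x w hn.symm; omega
    have := h.p4 hw hxz.symm hxy hwx (fun h => hyz h.symm) huw.symm h2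
    have := hd.le_succ y w this.symm
    omega

/-- Two neighbours `a`, `z` of `x` in the level below that of `x` have the same neighbours `w` two
levels below `x`. -/
theorem lower_of_common_upper (hd : IsLeveling G v d) (h : CommonNeighborOnWalks G)
    {x a z w : V} (hxa : G.Adj x a) (hxz : G.Adj x z) (ha : d a + 1 = d x) (hz : d z + 1 = d x)
    (hw : d w + 2 = d x) (haw : G.Adj a w) : G.Adj z w := by
  induction hk : d w generalizing x a z w with
  | zero =>
    obtain ⟨y', hy', hd'⟩ := hd.exists_lower z (by omega)
    rw [hd.eq_root w hk, ← hd.eq_root y' (by omega)]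
    exact hy'.symm
  | succ k ih =>
    by_contra hzw
    have hne : a ≠ z := by rintro rfl; exact hzw haw
    by_cases haz : G.Adj a z
    · exact hzw (hd.lower_of_adj h haz (by omega) (by omega) haw)
    obtain ⟨u, h1, h2, h3⟩ := hd.exists_common_below h hne haz hxa.symm hxz
    have := hd.le_succ a u h1
    obtain ⟨t, ht, hdt⟩ := hd.exists_lower w (by omega)
    have hut : G.Adj u t := ih haw h1 (by omega) (by omega) (by omega) ht.symm (by omega)
    have hwx : ¬ G.Adj w x := fun hn => by have := hd.le_succ x w hn.symm; omega
    obtain ⟨s, hs, hs1, hs2⟩ := h (x := w) (y := x) (e := a) (by rintro rfl; omega) hwx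
      haw.symm hxa.symm (.cons ht.symm (.cons hut.symm (.cons h2 (.cons hxz.symm .nil))))
    have htx : ¬ G.Adj t x := fun hn => by have := hd.le_succ x t hn.symm; omega
    have hux : ¬ G.Adj u x := fun hn => by have := hd.le_succ x u hn.symm; omega
    simp only [SimpleGraph.Walk.support_cons, SimpleGraph.Walk.support_nil, List.mem_cons,
      List.not_mem_nil, or_false] at hs
    rcases hs with rfl | rfl | rfl | rfl | rfl
    · exact G.irrefl hs1
    · exact htx hs2
    · exact hux hs2
    · exact hzw hs1.symm
    · exact G.irrefl hs2

/-- In one level, the neighbourhoods in the level below are pairwise disjoint or nested. -/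
theorem laminar (hd : IsLeveling G v d) (h : CommonNeighborOnWalks G) {x y z a c : V}
    (hdxy : d x = d y) (hz : d z + 1 = d x) (ha : d a + 1 = d x) (hc : d c + 1 = d x)
    (hxz : G.Adj x z) (hyz : G.Adj y z) (hxa : G.Adj x a) (hyc : G.Adj y c)
    (hya : ¬ G.Adj y a) : G.Adj x c := by
  by_contra hxc
  have hxy : ¬ G.Adj x y := fun hn => hya (hd.lower_of_adj h hn hdxy ha hxa)
  by_cases hz0 : d z = 0
  · exact hya (by rwa [hd.eq_root a (by omega), ← hd.eq_root z hz0])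
  obtain ⟨w, hw, hdw⟩ := hd.exists_lower z hz0
  have haw := hd.lower_of_common_upper h hxz hxa hz ha (by omega) hw.symm
  have hcw := hd.lower_of_common_upper h hyz hyc (by omega) (by omega) (by omega) hw.symm
  by_cases hac : G.Adj a c
  · exact hxy (h.p4 hxa hac hyc.symm hxc (fun h => hya h.symm) hxz hyz.symm)
  obtain ⟨u, hu, h1, h2⟩ := h (x := a) (y := c) (e := w) (by rintro rfl; exact hya hyc) hac haw
    hcw.symm (.cons hxa.symm (.cons hxz (.cons hyz.symm (.cons hyc .nil))))
  have hxw : ¬ G.Adj x w := fun hn => by have := hd.le_succ x w hn; omega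
  simp only [SimpleGraph.Walk.support_cons, SimpleGraph.Walk.support_nil, List.mem_cons,
    List.not_mem_nil, or_false] at hu
  rcases hu with rfl | rfl | rfl | rfl | rfl
  · exact G.irrefl h1
  · exact hxc h2
  · exact hxc (h.p4 hxa haw hcw.symm hxw hac hxz h2)
  · exact hya h1.symm
  · exact G.irrefl h2

end IsLeveling

/-- A set of at least two vertices that has no induced `P₄` and cannot be distinguished from
outside contains twins of the whole graph. -/
theorem exists_twins_of_module {V : Type*} [Fintype V] {G : SimpleGraph V} (A : Set V)
    (h2 : A.Nontrivial)
    (hP : ∀ a ∈ A, ∀ b ∈ A, ∀ c ∈ A, ∀ d ∈ A, G.Adj a b → G.Adj b c → G.Adj c d →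
      ¬ G.Adj a c → ¬ G.Adj b d → G.Adj a d)
    (hA : ∀ u ∉ A, ∀ a ∈ A, ∀ b ∈ A, G.Adj a u → G.Adj b u) :
    ∃ i j : V, i ≠ j ∧ ∀ k, k ≠ i → k ≠ j → (G.Adj i k ↔ G.Adj j k) := by
  classical
  obtain ⟨i, hi, j, hj, hij, h⟩ := P4FreeOn.exists_twins (G := G) A.toFinset
    (by simpa only [P4FreeOn, Set.mem_toFinset] using hP)
    (by
      obtain ⟨x, hx, y, hy, hxy⟩ := h2
      exact Finset.one_lt_card.2 ⟨x, by simpa, y, by simpa, hxy⟩)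
  rw [Set.mem_toFinset] at hi hj
  refine ⟨i, j, hij, fun k hki hkj => ?_⟩
  by_cases hk : k ∈ A
  · exact h k (by simpa using hk) hki hkj
  · exact ⟨hA k hk i hi j hj, hA k hk j hj i hi⟩

/-- Within `S`, the vertices `i` and `j` are twins, or `j` has no neighbour except possibly `i`. -/
def IsPruningPair {V : Type*} (G : SimpleGraph V) (S : Set V) (i j : V) : Prop :=
  (∀ k ∈ S, k ≠ i → k ≠ j → (G.Adj i k ↔ G.Adj j k)) ∨
    ∀ k ∈ S, k ≠ i → k ≠ j → ¬ G.Adj j k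

/-- The connected case: among the vertices farthest from a root, take one with fewest neighbours
below. If others have the same neighbours below, their class is a `P₄`-free set that no outside
vertex distinguishes. Otherwise the vertex is pendant, or its neighbourhood is such a set. -/
theorem CommonNeighborOnWalks.exists_isPruningPair_of_connected {V : Type*} [Finite V]
    [Nontrivial V] {G : SimpleGraph V} (h : CommonNeighborOnWalks G) (hG : G.Connected) :
    ∃ i j : V, i ≠ j ∧ IsPruningPair G Set.univ i j := by
  classical
  have := Fintype.ofFinite V
  obtain ⟨v, v', hvv'⟩ := exists_pair_ne V
  obtain ⟨d, hd⟩ : ∃ d, IsLeveling G v d := ⟨_, isLeveling_dist hG v⟩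
  obtain ⟨m, hm⟩ := Finite.exists_max d
  have hm0 : d m ≠ 0 := fun h0 => hvv' (hd.eq_root v' (by have := hm v'; omega)).symm
  -- the neighbours in the level below
  let N : V → Finset V := fun x => Finset.univ.filter fun z => G.Adj x z ∧ d z + 1 = d x
  have hN : ∀ x z, z ∈ N x ↔ G.Adj x z ∧ d z + 1 = d x := fun x z => by simp [N]
  have hlevel : ∀ x y, d x = d m → G.Adj x y → d y = d m ∨ d y + 1 = d m := fun x y hx hxy => by
    have := hd.le_succ x y hxy
    have := hm y
    omega
  have hNadj : ∀ x y, d x = d m → d y = d m → G.Adj x y → N x = N y := fun x y hx hy hxy => by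
    ext z
    rw [hN, hN]
    constructor
    · rintro ⟨h1, h2⟩
      exact ⟨hd.lower_of_adj h hxy (by omega) (by omega) h1, by omega⟩
    · rintro ⟨h1, h2⟩
      exact ⟨hd.lower_of_adj h hxy.symm (by omega) (by omega) h1, by omega⟩
  obtain ⟨x, hx, hmin⟩ := Finset.exists_min_image (Finset.univ.filter fun x => d x = d m)
    (fun x => (N x).card) ⟨m, by simp⟩
  simp only [Finset.mem_filter, Finset.mem_univ, true_and] at hx hmin
  obtain ⟨e, hex, hde⟩ := hd.exists_lower x (by omega)
  by_cases hQ : {y | d y = d m ∧ N y = N x}.Nontrivial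
  · obtain ⟨i, j, hij, hp⟩ := exists_twins_of_module (G := G) _ hQ
      (by
        rintro a ⟨ha, haN⟩ b hb c hc f ⟨hf, hfN⟩ hab hbc hcf hac hbf
        have hae : G.Adj a e := ((hN a e).1 (haN ▸ (hN x e).2 ⟨hex.symm, hde⟩)).1
        have hfe : G.Adj f e := ((hN f e).1 (hfN ▸ (hN x e).2 ⟨hex.symm, hde⟩)).1
        exact h.p4 hab hbc hcf hac hbf hae hfe.symm)
      (by
        rintro u hu a ⟨ha, haN⟩ b ⟨hb, hbN⟩ hau
        rcases hlevel a u ha hau with hdu | hdu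
        · exact absurd ⟨hdu, (hNadj a u ha hdu hau).symm.trans haN⟩ hu
        · exact ((hN b u).1 (hbN ▸ haN ▸ (hN a u).2 ⟨hau, by omega⟩)).1)
    exact ⟨i, j, hij, Or.inl fun k _ => hp k⟩
  have hxnbr : ∀ y, G.Adj x y → y ∈ N x := fun y hxy => by
    rcases hlevel x y hx hxy with hdy | hdy
    · refine absurd ⟨x, ⟨hx, rfl⟩, y, ⟨hdy, (hNadj x y hx hdy hxy).symm⟩, hxy.ne⟩ hQ
    · exact (hN x y).2 ⟨hxy, by omega⟩
  by_cases hA : ((N x : Set V)).Nontrivial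
  · obtain ⟨i, j, hij, hp⟩ := exists_twins_of_module (G := G) _ hA
      (by
        intro a ha b hb c hc f hf hab hbc hcf hac hbf
        exact h.p4 hab hbc hcf hac hbf ((hN _ _).1 ha).1.symm ((hN _ _).1 hf).1)
      (by
        intro u hu a ha b hb hau
        rw [Finset.mem_coe, hN] at ha hb
        have h1 := hd.le_succ a u hau
        have h2 := hd.le_succ u a hau.symm
        by_contra hbu
        rcases (by omega : d u = d m ∨ d u + 1 = d m ∨ d u + 2 = d m) with hdu | hdu | hdu
        · -- the neighbourhoods of `u` and `x` meet in `a`, so they are nested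
          refine hbu ?_
          have hsub : N u ⊆ N x := fun c hc => by
            rw [hN] at hc
            refine (hN x c).2 ⟨?_, by omega⟩
            exact hd.laminar h (by omega) ha.2 hb.2 (by omega) ha.1 hau.symm hb.1 hc.1
              fun h => hbu h.symm
          have heq := Finset.eq_of_subset_of_card_le hsub (hmin u hdu)
          exact ((hN u b).1 (heq ▸ (hN x b).2 hb)).1.symm
        · have ha0 : d a ≠ 0 := fun h0 => by
            refine hu ?_
            rw [hd.eq_root u (by omega), ← hd.eq_root a h0, Finset.mem_coe, hN]
            exact ha
          obtain ⟨w, hw, hdw⟩ := hd.exists_lower a ha0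
          have huw := hd.lower_of_adj h hau (by omega) (by omega) hw.symm
          have hbw := hd.lower_of_common_upper h ha.1 hb.1 ha.2 hb.2 (by omega) hw.symm
          have hxw : ¬ G.Adj x w := fun hn => by have := hd.le_succ x w hn; omega
          exact hu (hxnbr u (h.p4 hb.1 hbw huw.symm hxw hbu ha.1 hau))
        · exact hbu (hd.lower_of_common_upper h ha.1 hb.1 ha.2 hb.2 (by omega) hau))
    exact ⟨i, j, hij, Or.inl fun k _ => hp k⟩
  · rw [Set.not_nontrivial_iff] at hA
    refine ⟨e, x, hex.ne, Or.inr fun k _ hke _ hxk => hke ?_⟩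
    exact hA (hxnbr k hxk) (hxnbr e hex.symm)

/-- Every set of at least two vertices of a distance-hereditary graph contains a pruning pair: a
vertex without neighbours in the set, or a pair inside a connected component. -/
theorem CommonNeighborOnWalks.exists_isPruningPair {V : Type*} {G : SimpleGraph V}
    (h : CommonNeighborOnWalks G) (S : Finset V) (hS : 2 ≤ S.card) :
    ∃ i ∈ S, ∃ j ∈ S, i ≠ j ∧ IsPruningPair G S i j := by
  classical
  obtain ⟨i, hi, j, hj, hij⟩ := Finset.one_lt_card.1 hS
  by_cases hiso : ∀ k ∈ S, ¬ G.Adj j k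
  · exact ⟨i, hi, j, hj, hij, Or.inr fun k hk _ _ => hiso k hk⟩
  push Not at hiso
  obtain ⟨k, hk, hjk⟩ := hiso
  let H := G.induce (S : Set V)
  let j' : (S : Set V) := ⟨j, hj⟩
  let k' : (S : Set V) := ⟨k, hk⟩
  let C : Set (S : Set V) := {x | H.Reachable j' x}
  have hjk' : H.Adj j' k' := hjk
  have hC : (H.induce C).Connected := by
    have := (H.connectedComponentMk j').connected_toSimpleGraph
    have hs : (H.connectedComponentMk j').supp = C := by
      ext x
      simp only [SimpleGraph.ConnectedComponent.mem_supp_iff, SimpleGraph.ConnectedComponent.eq, C,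
        Set.mem_ofPred_eq]
      exact ⟨fun h => h.symm, fun h => h.symm⟩
    rw [← hs]
    exact this
  have : Nontrivial C := ⟨⟨⟨j', SimpleGraph.Reachable.refl _⟩, ⟨k', hjk'.reachable⟩, fun h =>
    hjk.ne (congrArg (fun x : C => ((x : (S : Set V)) : V)) h)⟩⟩
  obtain ⟨a, b, hab, hp⟩ :=
    ((h.induce (S : Set V)).induce C).exists_isPruningPair_of_connected hC
  have hout : ∀ (a : C) (u : (S : Set V)), H.Adj a u → u ∈ C := fun a u hau =>
    SimpleGraph.Reachable.trans a.2 hau.reachable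
  refine ⟨a, a.1.2, b, b.1.2, fun h => hab (Subtype.ext (Subtype.ext h)), ?_⟩
  rcases hp with hp | hp
  · left
    intro u hu hua hub
    by_cases huC : (⟨u, hu⟩ : (S : Set V)) ∈ C
    · exact hp ⟨⟨u, hu⟩, huC⟩ trivial
        (fun h => hua (congrArg (fun x : C => ((x : (S : Set V)) : V)) h))
        (fun h => hub (congrArg (fun x : C => ((x : (S : Set V)) : V)) h))
    · exact iff_of_false (fun h => huC (hout a ⟨u, hu⟩ h)) (fun h => huC (hout b ⟨u, hu⟩ h))
  · right
    intro u hu hua hub hbu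
    exact hp ⟨⟨u, hu⟩, hout b ⟨u, hu⟩ hbu⟩ trivial
      (fun h => hua (congrArg (fun x : C => ((x : (S : Set V)) : V)) h))
      (fun h => hub (congrArg (fun x : C => ((x : (S : Set V)) : V)) h)) hbu

/-! ### A structured language and its compiler -/

/-- Arithmetic expressions over registers and memory. -/
inductive Expr : Type
  | var (r : ℕ) : Expr
  | num (k : ℕ) : Expr
  | add (a b : Expr) : Expr
  | sub (a b : Expr) : Expr
  | mul (a b : Expr) : Expr
  | load (a : Expr) : Expr

namespace Expr

/-- The value of an expression in the state `σ`. -/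
def eval (σ : State) : Expr → ℕ
  | var r => σ.reg r
  | num k => k
  | add a b => a.eval σ + b.eval σ
  | sub a b => a.eval σ - b.eval σ
  | mul a b => a.eval σ * b.eval σ
  | load a => σ.mem (a.eval σ)

/-- An exponent that bounds all intermediate values, see `Expr.eval_le`. -/
def size : Expr → ℕ
  | var _ => 1
  | num _ => 1
  | add a b => a.size + b.size
  | sub a b => a.size + b.size
  | mul a b => a.size + b.size
  | load a => a.size

/-- Only registers below `32` and constants at most `2` occur. The registers from `32` on are
reserved for intermediate results. -/
def wf : Expr → Bool
  | var r => decide (r < 32)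
  | num k => decide (k ≤ 2)
  | add a b => a.wf && b.wf
  | sub a b => a.wf && b.wf
  | mul a b => a.wf && b.wf
  | load a => a.wf

/-- Code that puts the value of the expression into register `d`, using registers from `d` on. -/
def compile : Expr → ℕ → Prog
  | var r, d => .copy d r
  | num k, d => .const d k
  | add a b, d => .seq (a.compile d) (.seq (b.compile (d + 1)) (.add d d (d + 1)))
  | sub a b, d => .seq (a.compile d) (.seq (b.compile (d + 1)) (.sub d d (d + 1)))
  | mul a b, d => .seq (a.compile d) (.seq (b.compile (d + 1)) (.mul d d (d + 1)))
  | load a, d => .seq (a.compile d) (.load d d)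

end Expr

/-- Structured commands. The only loop is `loop x y c`, which runs `c` with register `x` set to
`0, 1, …`, up to the value of register `y`. -/
inductive Cmd : Type
  | skip : Cmd
  | assign (x : ℕ) (e : Expr) : Cmd
  | store (a e : Expr) : Cmd
  | seq (c d : Cmd) : Cmd
  | ite (e f : Expr) (c d : Cmd) : Cmd
  | loop (x y : ℕ) (c : Cmd) : Cmd

namespace Cmd

/-- The registers that a command may change. -/
def writes : Cmd → List ℕ
  | skip => []
  | assign x _ => [x]
  | store _ _ => []
  | seq c d => c.writes ++ d.writes
  | ite _ _ c d => c.writes ++ d.writes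
  | loop x _ c => x :: c.writes

/-- Whether the command contains an instruction that changes the memory. -/
def stores : Cmd → Bool
  | skip => false
  | assign _ _ => false
  | store _ _ => true
  | seq c d => c.stores || d.stores
  | ite _ _ c d => c.stores || d.stores
  | loop _ _ c => c.stores

/-- Expressions are well formed and of size at most `m`, and loops leave their counter and their
limit alone. -/
def wf (m : ℕ) : Cmd → Bool
  | skip => true
  | assign x e => decide (x < 32) && e.wf && decide (e.size ≤ m)
  | store a e => a.wf && decide (a.size ≤ m) && e.wf && decide (e.size ≤ m)
  | seq c d => c.wf m && d.wf m
  | ite e f c d => e.wf && decide (e.size ≤ m) && f.wf && decide (f.size ≤ m) && c.wf m && d.wf m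
  | loop x y c => decide (x < 32) && decide (y < 32) && decide (x ≠ y) &&
      decide (x ∉ c.writes) && decide (y ∉ c.writes) && c.wf m

/-- Translation to the machine. Operands are evaluated into the reserved registers `32` and `33`. -/
def compile : Cmd → Prog
  | skip => .skip
  | assign x e => .seq (e.compile 32) (.copy x 32)
  | store a e => .seq (a.compile 32) (.seq (e.compile 33) (.store 32 33))
  | seq c d => .seq c.compile d.compile
  | ite e f c d => .seq (e.compile 32) (.seq (f.compile 33) (.ifLt 32 33 c.compile d.compile))
  | loop x y c => .seq (.const x 0)
      (.whileLt x y (.seq c.compile (.seq (.const 32 1) (.add x x 32))))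

/-- `i` rounds of a loop with counter `x`. -/
def rounds (x : ℕ) (f : State → State) (σ : State) : ℕ → State
  | 0 => σ
  | i + 1 => f ((rounds x f σ i).setReg x i)

/-- The state that a command leads to. -/
def run : Cmd → State → State
  | skip, σ => σ
  | assign x e, σ => σ.setReg x (e.eval σ)
  | store a e, σ => σ.setMem (a.eval σ) (e.eval σ)
  | seq c d, σ => d.run (c.run σ)
  | ite e f c d, σ => if e.eval σ < f.eval σ then c.run σ else d.run σ
  | loop x y c, σ => (rounds x c.run σ (σ.reg y)).setReg x (σ.reg y)

/-- All numbers assigned are at most `X`, and no loop has more than `N` rounds. -/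
def Safe (X N : ℕ) : Cmd → State → Prop
  | skip, _ => True
  | assign _ e, σ => e.eval σ ≤ X
  | store _ e, σ => e.eval σ ≤ X
  | seq c d, σ => c.Safe X N σ ∧ d.Safe X N (c.run σ)
  | ite e f c d, σ => if e.eval σ < f.eval σ then c.Safe X N σ else d.Safe X N σ
  | loop x y c, σ => σ.reg y ≤ N ∧
      ∀ i < σ.reg y, c.Safe X N ((rounds x c.run σ i).setReg x i)

/-- Nested loops with the counters `l` and the common limit `y`. -/
def nest : List ℕ → ℕ → Cmd → Cmd
  | [], _, c => c
  | x :: l, y, c => loop x y (nest l y c)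

end Cmd

/-! ### Running times -/

namespace Prog

/-- A bound for the number of steps if every loop has at most `N` rounds. -/
def cost (N : ℕ) : Prog → ℕ
  | seq c d => c.cost N + d.cost N
  | ifLt _ _ c d => max (c.cost N) (d.cost N) + 1
  | whileLt _ _ c => N * (c.cost N + 1) + 1
  | _ => 1

/-- The constant factor in the bound `Prog.cost_le`. -/
def size : Prog → ℕ
  | seq c d => c.size + d.size
  | ifLt _ _ c d => c.size + d.size + 1
  | whileLt _ _ c => c.size + 2
  | _ => 1

/-- Depth of the nesting of loops. -/
def depth : Prog → ℕ
  | seq c d => max c.depth d.depth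
  | ifLt _ _ c d => max c.depth d.depth
  | whileLt _ _ c => c.depth + 1
  | _ => 0

theorem cost_le (N : ℕ) (hN : 1 ≤ N) (c : Prog) : c.cost N ≤ c.size * N ^ c.depth := by
  induction c with
  | seq c d hc hd =>
    simp only [cost, size, depth, add_mul]
    refine add_le_add (hc.trans ?_) (hd.trans ?_) <;> gcongr <;> simp
  | ifLt r s c d hc hd =>
    simp only [cost, size, depth, add_mul]
    have h1 : c.size * N ^ c.depth ≤ c.size * N ^ max c.depth d.depth := by gcongr; simp
    have h2 : d.size * N ^ d.depth ≤ d.size * N ^ max c.depth d.depth := by gcongr; simp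
    have h3 : 1 ≤ N ^ max c.depth d.depth := Nat.one_le_pow _ _ hN
    have h4 : max (c.cost N) (d.cost N) ≤ c.cost N + d.cost N := by omega
    omega
  | whileLt r s c hc =>
    simp only [cost, size, depth, add_mul, pow_succ]
    have h1 : 1 ≤ N ^ c.depth := Nat.one_le_pow _ _ hN
    have h2 : N * (c.cost N + 1) ≤ N * (c.size * N ^ c.depth + N ^ c.depth) :=
      Nat.mul_le_mul_left _ (by omega)
    have h3 : 1 * 1 ≤ N ^ c.depth * N := Nat.mul_le_mul h1 hN
    nlinarith
  | _ => simp [cost, size, depth]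

end Prog

/-! ### Correctness of the compiler -/

/-- All numbers in the state, apart from the reserved registers, are at most `X`. -/
def State.BoundedBy (X : ℕ) (σ : State) : Prop :=
  (∀ r < 32, σ.reg r ≤ X) ∧ ∀ a, σ.mem a ≤ X

/-- Equality up to the reserved registers. -/
def State.Agrees (σ τ : State) : Prop :=
  σ.mem = τ.mem ∧ ∀ r < 32, σ.reg r = τ.reg r

@[simp] theorem State.setReg_reg (σ : State) (r v s : ℕ) :
    (σ.setReg r v).reg s = if s = r then v else σ.reg s := by
  simp [State.setReg, Function.update_apply]

@[simp] theorem State.setReg_mem (σ : State) (r v : ℕ) : (σ.setReg r v).mem = σ.mem := rfl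

@[simp] theorem State.setMem_reg (σ : State) (a v : ℕ) : (σ.setMem a v).reg = σ.reg := rfl

@[simp] theorem State.setMem_mem (σ : State) (a v x : ℕ) :
    (σ.setMem a v).mem x = if x = a then v else σ.mem x := by
  simp [State.setMem, Function.update_apply]

namespace Expr

theorem size_pos (e : Expr) : 1 ≤ e.size := by
  induction e <;> simp only [size] <;> omega

theorem add_pow_le {X a b : ℕ} (hX : 2 ≤ X) (ha : 1 ≤ a) (hb : 1 ≤ b) :
    X ^ a + X ^ b ≤ X ^ (a + b) := by
  have h1 : X ^ 1 ≤ X ^ a := Nat.pow_le_pow_right (by omega) ha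
  have h2 : X ^ 1 ≤ X ^ b := Nat.pow_le_pow_right (by omega) hb
  rw [pow_add]
  nlinarith

theorem eval_le {X : ℕ} (hX : 2 ≤ X) {σ : State} (hσ : σ.BoundedBy X) (e : Expr)
    (he : e.wf = true) : e.eval σ ≤ X ^ e.size := by
  induction e with
  | var r => simpa [eval, size] using hσ.1 r (by simpa [wf] using he)
  | num k =>
    have : k ≤ 2 := by simpa [wf] using he
    simpa [eval, size] using this.trans hX
  | add a b iha ihb =>
    simp only [wf, Bool.and_eq_true] at he
    exact (add_le_add (iha he.1) (ihb he.2)).trans (add_pow_le hX a.size_pos b.size_pos)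
  | sub a b iha ihb =>
    simp only [wf, Bool.and_eq_true] at he
    exact (Nat.sub_le _ _).trans ((iha he.1).trans
      (Nat.pow_le_pow_right (by omega) (Nat.le_add_right _ _)))
  | mul a b iha ihb =>
    simp only [wf, Bool.and_eq_true] at he
    simp only [eval, size, pow_add]
    exact Nat.mul_le_mul (iha he.1) (ihb he.2)
  | load a iha =>
    simp only [eval, size]
    exact (hσ.2 _).trans (Nat.le_self_pow (by have := a.size_pos; omega) _)

/-- Started in a state that agrees with `σ`, the code `p d` puts `v` into register `d` and changes
neither the memory nor a register below `d`. -/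
def Computes (M N : ℕ) (σ : State) (p : ℕ → Prog) (v : ℕ) : Prop :=
  ∀ d, 32 ≤ d → ∀ σ' : State, σ'.Agrees σ → ∃ t τ, Exec M (p d) σ' t τ ∧ t ≤ (p d).cost N ∧
    τ.mem = σ'.mem ∧ (∀ r < d, τ.reg r = σ'.reg r) ∧ τ.reg d = v

theorem Computes.binary {M N : ℕ} {σ : State} {p q : ℕ → Prog} {u v w : ℕ}
    {op : ℕ → ℕ → ℕ → Prog} (hp : Computes M N σ p u) (hq : Computes M N σ q v)
    (hop : ∀ d (τ : State), τ.reg d = u → τ.reg (d + 1) = v →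
      Exec M (op d d (d + 1)) τ 1 (τ.setReg d w))
    (hcost : ∀ d, 1 ≤ (op d d (d + 1)).cost N) :
    Computes M N σ (fun d => .seq (p d) (.seq (q (d + 1)) (op d d (d + 1)))) w := by
  intro d hd σ' hs
  obtain ⟨t₁, τ₁, h1, ht1, hm1, hr1, hv1⟩ := hp d hd σ' hs
  obtain ⟨t₂, τ₂, h2, ht2, hm2, hr2, hv2⟩ := hq (d + 1) (by omega) τ₁
    ⟨hm1.trans hs.1, fun r hr => (hr1 r (by omega)).trans (hs.2 r hr)⟩
  refine ⟨_, _, .seq h1 (.seq h2 (hop d τ₂ ((hr2 d (by omega)).trans hv1) hv2)), ?_,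
    hm2.trans hm1, fun r hr => ?_, by simp⟩
  · have := hcost d
    simp only [Prog.cost]
    omega
  · simp only [State.setReg_reg, hr.ne, if_false]
    exact (hr2 r (by omega)).trans (hr1 r hr)

theorem computes_compile {X M : ℕ} (N : ℕ) (hX : 2 ≤ X) {σ : State} (hσ : σ.BoundedBy X)
    (e : Expr) (he : e.wf = true) (hM : X ^ e.size ≤ M) :
    Computes M N σ e.compile (e.eval σ) := by
  have hval := (eval_le hX hσ e he).trans hM
  have mono : ∀ {i j : ℕ}, i ≤ j → X ^ j ≤ M → X ^ i ≤ M := fun hij h =>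
    (Nat.pow_le_pow_right (by omega) hij).trans h
  induction e with
  | var r =>
    intro d hd σ' hs
    have hr : σ'.reg r = σ.reg r := hs.2 r (by simpa [wf] using he)
    refine ⟨_, _, .copy σ' d r (by simpa [hr, eval] using hval), by simp [compile, Prog.cost], rfl,
      fun s hsd => by simp [hsd.ne], by simp [eval, hr]⟩
  | num k =>
    intro d hd σ' hs
    exact ⟨_, _, .const σ' d k (by simpa [eval] using hval), by simp [compile, Prog.cost], rfl,
      fun s hsd => by simp [hsd.ne], by simp [eval]⟩
  | add a b iha ihb =>
    simp only [wf, Bool.and_eq_true] at he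
    have ha := mono (Nat.le_add_right a.size b.size) hM
    have hb := mono (Nat.le_add_left b.size a.size) hM
    refine (iha he.1 ha ((eval_le hX hσ a he.1).trans ha)).binary
      (ihb he.2 hb ((eval_le hX hσ b he.2).trans hb)) (fun d τ h1 h2 => ?_) fun _ => le_rfl
    have := Exec.add (M := M) τ d d (d + 1) (by rw [h1, h2]; exact hval)
    rwa [h1, h2] at this
  | sub a b iha ihb =>
    simp only [wf, Bool.and_eq_true] at he
    have ha := mono (Nat.le_add_right a.size b.size) hM
    have hb := mono (Nat.le_add_left b.size a.size) hM
    refine (iha he.1 ha ((eval_le hX hσ a he.1).trans ha)).binary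
      (ihb he.2 hb ((eval_le hX hσ b he.2).trans hb)) (fun d τ h1 h2 => ?_) fun _ => le_rfl
    have := Exec.sub (M := M) τ d d (d + 1) (by rw [h1, h2]; exact hval)
    rwa [h1, h2] at this
  | mul a b iha ihb =>
    simp only [wf, Bool.and_eq_true] at he
    have ha := mono (Nat.le_add_right a.size b.size) hM
    have hb := mono (Nat.le_add_left b.size a.size) hM
    refine (iha he.1 ha ((eval_le hX hσ a he.1).trans ha)).binary
      (ihb he.2 hb ((eval_le hX hσ b he.2).trans hb)) (fun d τ h1 h2 => ?_) fun _ => le_rfl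
    have := Exec.mul (M := M) τ d d (d + 1) (by rw [h1, h2]; exact hval)
    rwa [h1, h2] at this
  | load a iha =>
    intro d hd σ' hs
    obtain ⟨t, τ, h1, ht, hm, hr, hv⟩ :=
      iha he hM ((eval_le hX hσ a he).trans hM) d hd σ' hs
    have hl : τ.mem (τ.reg d) = (load a).eval σ := by rw [hv, hm, hs.1]; rfl
    refine ⟨_, _, .seq h1 (.load τ d d (by rw [hl]; exact hval)), ?_, hm, fun r hrd => ?_, ?_⟩
    · simp only [compile, Prog.cost]
      omega
    · simp only [State.setReg_reg, hrd.ne, if_false]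
      exact hr r hrd
    · simp [hl]

end Expr

theorem State.Agrees.trans {σ τ υ : State} (h₁ : σ.Agrees τ) (h₂ : τ.Agrees υ) : σ.Agrees υ :=
  ⟨h₁.1.trans h₂.1, fun r hr => (h₁.2 r hr).trans (h₂.2 r hr)⟩

theorem State.Agrees.setReg {σ τ : State} (h : σ.Agrees τ) (x v : ℕ) :
    (σ.setReg x v).Agrees (τ.setReg x v) :=
  ⟨h.1, fun r hr => by simp only [State.setReg_reg]; rw [h.2 r hr]⟩

theorem State.BoundedBy.setReg {X : ℕ} {σ : State} (h : σ.BoundedBy X) {x v : ℕ} (hv : v ≤ X) :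
    (σ.setReg x v).BoundedBy X :=
  ⟨fun r hr => by simp only [State.setReg_reg]; split_ifs; exacts [hv, h.1 r hr], h.2⟩

theorem State.BoundedBy.setMem {X : ℕ} {σ : State} (h : σ.BoundedBy X) {x v : ℕ} (hv : v ≤ X) :
    (σ.setMem x v).BoundedBy X :=
  ⟨h.1, fun r => by simp only [State.setMem_mem]; split_ifs; exacts [hv, h.2 r]⟩

namespace Cmd

theorem run_reg (c : Cmd) (σ : State) (r : ℕ) (hr : r ∉ c.writes) :
    (c.run σ).reg r = σ.reg r := by
  induction c generalizing σ with
  | skip => rfl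
  | assign x e => simpa [run] using fun h => absurd h (by simpa [writes] using hr)
  | store a e => rfl
  | seq c d hc hd =>
    simp only [writes, List.mem_append, not_or] at hr
    exact (hd _ hr.2).trans (hc _ hr.1)
  | ite e f c d hc hd =>
    simp only [writes, List.mem_append, not_or] at hr
    simp only [run]
    split_ifs
    exacts [hc _ hr.1, hd _ hr.2]
  | loop x y c hc =>
    simp only [writes, List.mem_cons, not_or] at hr
    have : ∀ i, (rounds x c.run σ i).reg r = σ.reg r := fun i => by
      induction i with
      | zero => rfl
      | succ i ih => simp [rounds, hc _ hr.2, hr.1, ih]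
    simp [run, hr.1, this]

theorem run_mem (c : Cmd) (σ : State) (h : c.stores = false) : (c.run σ).mem = σ.mem := by
  induction c generalizing σ with
  | skip => rfl
  | assign x e => rfl
  | store a e => simp [stores] at h
  | seq c d hc hd =>
    simp only [stores, Bool.or_eq_false_iff] at h
    exact (hd _ h.2).trans (hc _ h.1)
  | ite e f c d hc hd =>
    simp only [stores, Bool.or_eq_false_iff] at h
    simp only [run]
    split_ifs
    exacts [hc _ h.1, hd _ h.2]
  | loop x y c hc =>
    have : ∀ i, (rounds x c.run σ i).mem = σ.mem := fun i => by
      induction i with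
      | zero => rfl
      | succ i ih => simp [rounds, hc _ h, ih]
    simp [run, this]

/-- The compiled program does what the command says, within the syntactic time bound. -/
theorem exec_compile {X M N m : ℕ} (hX : 2 ≤ X) (hm : 1 ≤ m) (hM : X ^ m ≤ M) (c : Cmd)
    (hwf : c.wf m = true) (σ : State) (hsafe : c.Safe X N σ) (hσ : σ.BoundedBy X) (σ' : State)
    (hs : σ'.Agrees σ) :
    ∃ t τ, Exec M c.compile σ' t τ ∧ t ≤ c.compile.cost N ∧ τ.Agrees (c.run σ) ∧
      (c.run σ).BoundedBy X := by
  have mono : ∀ {i : ℕ}, i ≤ m → X ^ i ≤ M := fun hij =>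
    (Nat.pow_le_pow_right (by omega) hij).trans hM
  -- evaluation of two expressions into registers `32` and `33`
  have pair : ∀ (e f : Expr) (σ σ' : State), e.wf = true → e.size ≤ m → f.wf = true →
      f.size ≤ m → σ.BoundedBy X → σ'.Agrees σ → ∃ t u ρ τ,
        Exec M (e.compile 32) σ' t ρ ∧ Exec M (f.compile 33) ρ u τ ∧
        t ≤ (e.compile 32).cost N ∧ u ≤ (f.compile 33).cost N ∧ τ.Agrees σ ∧
        τ.reg 32 = e.eval σ ∧ τ.reg 33 = f.eval σ := by
    intro e f σ σ' he hem hf hfm hσ hs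
    obtain ⟨t₁, τ₁, h1, ht1, hm1, hr1, hv1⟩ :=
      Expr.computes_compile N hX hσ e he (mono hem) 32 le_rfl σ' hs
    have hs1 : τ₁.Agrees σ := ⟨hm1.trans hs.1, fun r hr => (hr1 r hr).trans (hs.2 r hr)⟩
    obtain ⟨t₂, τ₂, h2, ht2, hm2, hr2, hv2⟩ :=
      Expr.computes_compile N hX hσ f hf (mono hfm) 33 (by omega) τ₁ hs1
    exact ⟨t₁, t₂, τ₁, τ₂, h1, h2, ht1, ht2,
      ⟨hm2.trans hs1.1, fun r hr => (hr2 r (by omega)).trans (hs1.2 r hr)⟩,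
      (hr2 32 (by omega)).trans hv1, hv2⟩
  induction c generalizing σ σ' with
  | skip => exact ⟨_, _, .skip σ', by simp [compile, Prog.cost], hs, hσ⟩
  | assign x e =>
    simp only [wf, Bool.and_eq_true, decide_eq_true_eq] at hwf
    obtain ⟨t, τ, h1, ht, hm, hr, hv⟩ :=
      Expr.computes_compile N hX hσ e hwf.1.2 (mono hwf.2) 32 le_rfl σ' hs
    have hle := (Expr.eval_le hX hσ e hwf.1.2).trans (mono hwf.2)
    refine ⟨_, _, .seq h1 (.copy τ x 32 (by rwa [hv])), ?_, ?_, hσ.setReg hsafe⟩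
    · simp only [compile, Prog.cost]
      omega
    · rw [hv]
      exact State.Agrees.setReg ⟨hm.trans hs.1, fun r hr' => (hr r hr').trans (hs.2 r hr')⟩ _ _
  | store a e =>
    simp only [wf, Bool.and_eq_true, decide_eq_true_eq] at hwf
    obtain ⟨t, u, ρ, τ, h1, h2, ht, hu, hτ, hva, hve⟩ :=
      pair a e σ σ' hwf.1.1.1 hwf.1.1.2 hwf.1.2 hwf.2 hσ hs
    have hle := (Expr.eval_le hX hσ e hwf.1.2).trans (mono hwf.2)
    refine ⟨_, _, .seq h1 (.seq h2 (.store τ 32 33 (by rwa [hve]))), ?_, ?_, hσ.setMem hsafe⟩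
    · simp only [compile, Prog.cost]
      omega
    · rw [hva, hve]
      exact ⟨by simp only [run, State.setMem, hτ.1], hτ.2⟩
  | seq c d hc hd =>
    simp only [wf, Bool.and_eq_true] at hwf
    obtain ⟨t, τ, h1, ht, hs1, hb1⟩ := hc hwf.1 σ hsafe.1 hσ σ' hs
    obtain ⟨u, υ, h2, hu, hs2, hb2⟩ := hd hwf.2 _ hsafe.2 hb1 τ hs1
    exact ⟨_, _, .seq h1 h2, add_le_add ht hu, hs2, hb2⟩
  | ite e f c d hc hd =>
    simp only [wf, Bool.and_eq_true, decide_eq_true_eq] at hwf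
    obtain ⟨t, u, ρ, τ, h1, h2, ht, hu, hτ, hve, hvf⟩ :=
      pair e f σ σ' hwf.1.1.1.1.1 hwf.1.1.1.1.2 hwf.1.1.1.2 hwf.1.1.2 hσ hs
    simp only [Safe] at hsafe
    by_cases hlt : e.eval σ < f.eval σ
    · rw [if_pos hlt] at hsafe
      obtain ⟨s, υ, h3, hs3, hs4, hb⟩ := hc hwf.1.2 σ hsafe hσ τ hτ
      refine ⟨_, υ, .seq h1 (.seq h2 (.ifTrue (by rwa [hve, hvf]) h3)), ?_, ?_⟩
      · simp only [compile, Prog.cost]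
        omega
      · simpa only [run, if_pos hlt] using ⟨hs4, hb⟩
    · rw [if_neg hlt] at hsafe
      obtain ⟨s, υ, h3, hs3, hs4, hb⟩ := hd hwf.2 σ hsafe hσ τ hτ
      refine ⟨_, υ, .seq h1 (.seq h2 (.ifFalse (by rwa [hve, hvf]) h3)), ?_, ?_⟩
      · simp only [compile, Prog.cost]
        omega
      · simpa only [run, if_neg hlt] using ⟨hs4, hb⟩
  | loop x y c hc =>
    simp only [wf, Bool.and_eq_true, decide_eq_true_eq] at hwf
    obtain ⟨⟨⟨⟨⟨hx, hy⟩, hxy⟩, hxc⟩, hyc⟩, hcwf⟩ := hwf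
    obtain ⟨hN, hbody⟩ := hsafe
    have hM1 : X ≤ M := by simpa using mono hm
    set n := σ.reg y with hn
    have hnX : n ≤ X := hσ.1 y hy
    -- The body does not change the limit, so the loop runs exactly `n` times.
    have hry : ∀ i, (rounds x c.run σ i).reg y = n := fun i => by
      induction i with
      | zero => rfl
      | succ i ih => simp [rounds, run_reg c _ y hyc, Ne.symm hxy, ih]
    -- Here `j` is the number of rounds to go.
    have key : ∀ j i, i + j = n → ∀ ρ : State, ρ.Agrees ((rounds x c.run σ i).setReg x i) →
        (rounds x c.run σ i).BoundedBy X →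
        ∃ t τ, Exec M (.whileLt x y (.seq c.compile (.seq (.const 32 1) (.add x x 32)))) ρ t τ ∧
          t ≤ j * (c.compile.cost N + 2 + 1) + 1 ∧
          τ.Agrees ((rounds x c.run σ n).setReg x n) ∧ (rounds x c.run σ n).BoundedBy X := by
      intro j
      induction j with
      | zero =>
        intro i hi ρ hρ hb
        obtain rfl : i = n := by omega
        refine ⟨_, _, .whileFalse ?_, by omega, hρ, hb⟩
        rw [hρ.2 x hx, hρ.2 y hy]
        simp [Ne.symm hxy, hry]
      | succ j ih =>
        intro i hi ρ hρ hb
        obtain ⟨t, τ, h1, ht, hτ, hb1⟩ := hc hcwf _ (hbody i (by omega))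
          (hb.setReg (by omega : i ≤ X)) ρ hρ
        have hxi : τ.reg x = i := by rw [hτ.2 x hx, run_reg c _ x hxc]; simp
        have hx32 : x ≠ 32 := by omega
        have hτ' : (τ.setReg 32 1).Agrees (rounds x c.run σ (i + 1)) :=
          ⟨hτ.1, fun r hr => by
            rw [State.setReg_reg, if_neg hr.ne]; exact hτ.2 r hr⟩
        obtain ⟨u, υ, h2, hu, hυ, hb2⟩ := ih (i + 1) (by omega) ((τ.setReg 32 1).setReg x (i + 1))
          (hτ'.setReg _ _) hb1
        have hadd := Exec.add (M := M) (τ.setReg 32 1) x x 32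
          (by simp only [State.setReg_reg, if_neg hx32, hxi, if_true]; omega)
        simp only [State.setReg_reg, if_neg hx32, hxi, if_true] at hadd
        refine ⟨_, υ, .whileTrue ?_ (.seq h1 (.seq (.const τ 32 1 (by omega)) hadd)) h2, ?_, hυ,
          hb2⟩
        · rw [hρ.2 x hx, hρ.2 y hy]
          simp only [State.setReg_reg, if_true, if_neg (Ne.symm hxy), hry]
          omega
        · rw [add_mul]
          omega
    obtain ⟨t, τ, h1, ht, hτ, hb⟩ := key n 0 (by omega) (σ'.setReg x 0) (hs.setReg x 0) hσ
    refine ⟨_, τ, .seq (.const σ' x 0 (by omega)) h1, ?_, hτ, hb.setReg hnX⟩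
    have : n * (c.compile.cost N + 2 + 1) ≤ N * (c.compile.cost N + 2 + 1) :=
      Nat.mul_le_mul_right _ hN
    simp only [compile, Prog.cost, Nat.reduceAdd]
    omega

/-! ### Weakest preconditions -/

/-- Started in `σ`, the command stays within the bounds `X` for numbers and `N` for loops, and
establishes `Q`. -/
def WP (X N : ℕ) (c : Cmd) (Q : State → Prop) (σ : State) : Prop :=
  c.Safe X N σ ∧ Q (c.run σ)

section WP

variable {X N : ℕ} {Q Q' : State → Prop} {σ : State} {c d : Cmd}

theorem WP.mono (h : WP X N c Q σ) (hQ : ∀ τ, Q τ → Q' τ) : WP X N c Q' σ :=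
  ⟨h.1, hQ _ h.2⟩

/-- A command leaves the registers alone that it does not write to. -/
theorem WP.frame (h : WP X N c Q σ)
    (hQ : ∀ τ, (∀ r, r ∉ c.writes → τ.reg r = σ.reg r) → Q τ → Q' τ) : WP X N c Q' σ :=
  ⟨h.1, hQ _ (run_reg c σ) h.2⟩

theorem WP.mem_eq (h : WP X N c Q σ) (hc : c.stores = false) :
    WP X N c (fun τ => τ.mem = σ.mem ∧ Q τ) σ :=
  ⟨h.1, run_mem c σ hc, h.2⟩

theorem wp_skip : WP X N skip Q σ ↔ Q σ := by
  simp [WP, Safe, run]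

theorem wp_assign {x : ℕ} {e : Expr} :
    WP X N (assign x e) Q σ ↔ e.eval σ ≤ X ∧ Q (σ.setReg x (e.eval σ)) := Iff.rfl

theorem wp_store {a e : Expr} :
    WP X N (store a e) Q σ ↔ e.eval σ ≤ X ∧ Q (σ.setMem (a.eval σ) (e.eval σ)) := Iff.rfl

theorem wp_seq : WP X N (seq c d) Q σ ↔ WP X N c (WP X N d Q) σ := by
  simp [WP, Safe, run, and_assoc]

theorem wp_ite {e f : Expr} : WP X N (ite e f c d) Q σ ↔
    (e.eval σ < f.eval σ → WP X N c Q σ) ∧ (¬ e.eval σ < f.eval σ → WP X N d Q σ) := by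
  by_cases h : e.eval σ < f.eval σ <;> simp [WP, Safe, run, h]

/-- The rule for loops, with an invariant `I i` for the beginning of round `i`. -/
theorem wp_loop {x y : ℕ} (I : ℕ → State → Prop) (hN : σ.reg y ≤ N) (h0 : I 0 σ)
    (hstep : ∀ i < σ.reg y, ∀ τ : State, (∀ r, r ∉ x :: c.writes → τ.reg r = σ.reg r) → I i τ →
      WP X N c (I (i + 1)) (τ.setReg x i))
    (hQ : ∀ τ : State, (∀ r, r ∉ x :: c.writes → τ.reg r = σ.reg r) → I (σ.reg y) τ →
      Q (τ.setReg x (σ.reg y))) :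
    WP X N (loop x y c) Q σ := by
  have hframe : ∀ i r, r ∉ x :: c.writes → (rounds x c.run σ i).reg r = σ.reg r := fun i r hr => by
    rw [List.mem_cons, not_or] at hr
    induction i with
    | zero => rfl
    | succ i ih => simp [rounds, run_reg c _ r hr.2, hr.1, ih]
  have hI : ∀ i ≤ σ.reg y, I i (rounds x c.run σ i) := fun i => by
    induction i with
    | zero => exact fun _ => h0
    | succ i ih => exact fun hi => (hstep i hi _ (hframe i) (ih (by omega))).2
  exact ⟨⟨hN, fun i hi => (hstep i hi _ (hframe i) (hI i hi.le)).1⟩, hQ _ (hframe _) (hI _ le_rfl)⟩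

end WP

theorem writes_nest (l : List ℕ) (y : ℕ) (c : Cmd) : (nest l y c).writes = l ++ c.writes := by
  induction l with
  | nil => rfl
  | cons x l ih => simp [nest, writes, ih]

/-- The rule for nested loops. The invariant `I D` says that the body has been run for all values
of the counters in `D`; it must not depend on the counters. -/
theorem wp_nest {X N : ℕ} {c : Cmd} {y : ℕ} (l : List ℕ) (hl : l.Nodup)
    (hlc : ∀ x ∈ l, x ∉ c.writes) (hy : y ∉ l) (hyc : y ∉ c.writes) (n : ℕ) (hn : n ≤ N)
    (I : Set (List ℕ) → State → Prop) (hI : ∀ D τ x v, x ∈ l → I D τ → I D (τ.setReg x v))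
    (hstep : ∀ D (τ : State), I D τ → (∀ x ∈ l, τ.reg x < n) →
      WP X N c (I (insert (l.map τ.reg) D)) τ)
    (D : Set (List ℕ)) (σ : State) (hσ : σ.reg y = n) (h0 : I D σ) :
    WP X N (nest l y c) (I (D ∪ {vs | vs.length = l.length ∧ ∀ v ∈ vs, v < n})) σ := by
  induction l generalizing I D σ with
  | nil =>
    have hD : D ∪ {vs : List ℕ | vs.length = ([] : List ℕ).length ∧ ∀ v ∈ vs, v < n} =
        insert [] D := by
      ext vs
      simp only [List.length_nil, List.length_eq_zero_iff, Set.mem_union, Set.mem_ofPred_eq,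
        Set.mem_insert_iff]
      constructor
      · rintro (h | ⟨rfl, -⟩)
        exacts [Or.inr h, Or.inl rfl]
      · rintro (rfl | h)
        exacts [Or.inr ⟨rfl, by simp⟩, Or.inl h]
    rw [hD]
    exact hstep D σ h0 (by simp)
  | cons x l ih =>
    rw [List.nodup_cons] at hl
    simp only [List.mem_cons, not_or] at hy
    -- the tuples that begin with one of the first `i` values
    let E : ℕ → Set (List ℕ) := fun i =>
      {vs | ∃ v us, vs = v :: us ∧ v < i ∧ us.length = l.length ∧ ∀ v ∈ us, v < n}
    refine wp_loop (fun i => I (D ∪ E i)) (hσ ▸ hn) (by simpa [E] using h0) ?_ ?_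
    · intro i hi τ hτ hIτ
      rw [hσ] at hi
      rw [writes_nest] at hτ
      have hτy : (τ.setReg x i).reg y = n := by
        simp [hy.1, hτ y (by simp [hy, hyc]), hσ]
      refine (ih hl.2 (fun z hz => hlc z (by simp [hz])) hy.2
        (fun D' τ => I (D ∪ E i ∪ List.cons i '' D') τ ∧ τ.reg x = i) ?_ ?_ ∅ (τ.setReg x i) hτy
        ⟨by simpa using hI _ _ _ _ (by simp) hIτ, by simp⟩).mono ?_
      · rintro D' τ z v hz ⟨h1, h2⟩
        have hzx : x ≠ z := by rintro rfl; exact hl.1 hz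
        exact ⟨hI _ _ _ _ (by simp [hz]) h1, by simpa [hzx] using h2⟩
      · rintro D' τ ⟨h1, h2⟩ hlt
        refine (hstep _ τ h1 (by simpa [h2, hi] using hlt)).frame fun υ hυ hIυ => ⟨?_, ?_⟩
        · convert hIυ using 1
          rw [Set.image_insert_eq, List.map_cons, h2, Set.union_insert]
        · rw [hυ x (hlc x (by simp)), h2]
      · rintro υ ⟨hIυ, -⟩
        convert hIυ using 1
        ext vs
        simp only [Set.mem_union, Set.mem_ofPred_eq, E, Set.mem_image, Set.empty_union]
        constructor
        · rintro (h | ⟨v, us, rfl, hv, h⟩)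
          · exact Or.inl (Or.inl h)
          · rcases Nat.lt_succ_iff_lt_or_eq.1 hv with hv | rfl
            · exact Or.inl (Or.inr ⟨v, us, rfl, hv, h⟩)
            · exact Or.inr ⟨us, h, rfl⟩
        · rintro ((h | ⟨v, us, rfl, hv, h⟩) | ⟨us, h, rfl⟩)
          · exact Or.inl h
          · exact Or.inr ⟨v, us, rfl, by omega, h⟩
          · exact Or.inr ⟨i, us, rfl, by omega, h⟩
    · intro τ _ hIτ
      refine hI _ _ _ _ (by simp) ?_
      convert hIτ using 1
      ext vs
      simp only [Set.mem_union, Set.mem_ofPred_eq, E, hσ]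
      refine or_congr_right ⟨?_, ?_⟩
      · rintro ⟨hlen, hlt⟩
        match vs, hlen with
        | v :: us, hlen =>
          exact ⟨v, us, rfl, hlt v (by simp), by simpa using hlen, fun w hw => hlt w (by simp [hw])⟩
      · rintro ⟨v, us, rfl, hv, hlen, hlt⟩
        exact ⟨by simpa using hlen, by simpa [hv] using hlt⟩

end Cmd

/-! ### Colorings of clusters -/

/-- The cluster `C` with boundary `X` has a coloring with `p` black and `q` white vertices, of which
`f` and `g` belong to the boundary. -/
def ClusterColoring {V : Type*} [DecidableEq V] (G : SimpleGraph V) (C X : Finset V)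
    (f g p q : ℕ) : Prop :=
  ∃ B W : Finset V, B ⊆ C ∧ W ⊆ C ∧ Disjoint B W ∧ (∀ x ∈ B, ∀ y ∈ W, ¬ G.Adj x y) ∧
    (B ∩ X).card = f ∧ (W ∩ X).card = g ∧ B.card = p ∧ W.card = q

theorem ClusterColoring.le {V : Type*} [DecidableEq V] [Fintype V] {G : SimpleGraph V}
    {C X : Finset V} {f g p q : ℕ} (h : ClusterColoring G C X f g p q) :
    f ≤ Fintype.card V ∧ g ≤ Fintype.card V ∧ p ≤ Fintype.card V ∧ q ≤ Fintype.card V := by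
  obtain ⟨B, W, -, -, -, -, rfl, rfl, rfl, rfl⟩ := h
  exact ⟨Finset.card_le_univ _, Finset.card_le_univ _, Finset.card_le_univ _,
    Finset.card_le_univ _⟩

theorem clusterColoring_singleton {V : Type*} [DecidableEq V] {G : SimpleGraph V} {v : V}
    {f g p q : ℕ} : ClusterColoring G {v} {v} f g p q ↔
      (f = 0 ∧ g = 0 ∧ p = 0 ∧ q = 0) ∨ (f = 1 ∧ g = 0 ∧ p = 1 ∧ q = 0) ∨
        (f = 0 ∧ g = 1 ∧ p = 0 ∧ q = 1) := by
  constructor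
  · rintro ⟨B, W, hB, hW, hd, -, rfl, rfl, rfl, rfl⟩
    rw [Finset.subset_singleton_iff] at hB hW
    rcases hB with rfl | rfl <;> rcases hW with rfl | rfl <;> simp at hd ⊢
  · rintro (⟨rfl, rfl, rfl, rfl⟩ | ⟨rfl, rfl, rfl, rfl⟩ | ⟨rfl, rfl, rfl, rfl⟩)
    · exact ⟨∅, ∅, by simp⟩
    · exact ⟨{v}, ∅, by simp⟩
    · exact ⟨∅, {v}, by simp⟩

/-- Colorings of a union of two clusters. All possible edges between the two boundaries are present
if `a` holds, and none otherwise; the boundary of the union includes that of the second cluster if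
`k = 1`. -/
theorem clusterColoring_union {V : Type*} [DecidableEq V] {G : SimpleGraph V}
    {C₁ C₂ X₁ X₂ : Finset V} (hd : Disjoint C₁ C₂) (h₁ : X₁ ⊆ C₁) (h₂ : X₂ ⊆ C₂) {a : Prop}
    (hadj : ∀ x ∈ C₁, ∀ y ∈ C₂, G.Adj x y ↔ a ∧ x ∈ X₁ ∧ y ∈ X₂) {k : ℕ} (hk : k = 0 ∨ k = 1)
    {f g p q : ℕ} :
    ClusterColoring G (C₁ ∪ C₂) (X₁ ∪ if k = 1 then X₂ else ∅) f g p q ↔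
      ∃ f₁ g₁ p₁ q₁ f₂ g₂ p₂ q₂, f = f₁ + k * f₂ ∧ g = g₁ + k * g₂ ∧ p = p₁ + p₂ ∧ q = q₁ + q₂ ∧
        ClusterColoring G C₁ X₁ f₁ g₁ p₁ q₁ ∧ ClusterColoring G C₂ X₂ f₂ g₂ p₂ q₂ ∧
        (a → f₁ * g₂ + g₁ * f₂ = 0) := by
  -- `B₁ ⊆ C₁` and `B₂ ⊆ C₂` meet the new boundary as expected
  have hcard : ∀ B₁ B₂ : Finset V, B₁ ⊆ C₁ → B₂ ⊆ C₂ →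
      ((B₁ ∪ B₂) ∩ (X₁ ∪ if k = 1 then X₂ else ∅)).card = (B₁ ∩ X₁).card + k * (B₂ ∩ X₂).card := by
    intro B₁ B₂ hB₁ hB₂
    rw [Finset.disjoint_left] at hd
    have hdis : Disjoint (B₁ ∩ X₁) (B₂ ∩ X₂) := by
      rw [Finset.disjoint_left]
      intro x hx hx'
      exact hd (hB₁ (Finset.mem_inter.1 hx).1) (hB₂ (Finset.mem_inter.1 hx').1)
    rcases hk with rfl | rfl
    · rw [zero_mul, add_zero]
      congr 1
      ext x
      have := @hB₁ x
      have := @hB₂ x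
      have := @h₁ x
      have := @hd x
      simp only [Finset.mem_inter, Finset.mem_union, zero_ne_one, if_false, Finset.notMem_empty]
      tauto
    · rw [one_mul, ← Finset.card_union_of_disjoint hdis]
      congr 1
      ext x
      have := @hB₁ x
      have := @hB₂ x
      have := @h₁ x
      have := @h₂ x
      have := @hd x
      simp only [Finset.mem_inter, Finset.mem_union, if_true]
      tauto
  constructor
  · rintro ⟨B, W, hB, hW, hBW, hE, rfl, rfl, rfl, rfl⟩
    have hsplit : ∀ B : Finset V, B ⊆ C₁ ∪ C₂ → B = (B ∩ C₁) ∪ (B ∩ C₂) := fun B hB => by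
      rw [← Finset.inter_union_distrib_left, Finset.inter_eq_left.2 hB]
    have hdis : ∀ B : Finset V, Disjoint (B ∩ C₁) (B ∩ C₂) := fun B =>
      hd.mono Finset.inter_subset_right Finset.inter_subset_right
    refine ⟨_, _, _, _, _, _, _, _, ?_, ?_, ?_, ?_,
      ⟨B ∩ C₁, W ∩ C₁, Finset.inter_subset_right, Finset.inter_subset_right,
        hBW.mono Finset.inter_subset_left Finset.inter_subset_left,
        fun x hx y hy => hE x (Finset.mem_inter.1 hx).1 y (Finset.mem_inter.1 hy).1,
        rfl, rfl, rfl, rfl⟩,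
      ⟨B ∩ C₂, W ∩ C₂, Finset.inter_subset_right, Finset.inter_subset_right,
        hBW.mono Finset.inter_subset_left Finset.inter_subset_left,
        fun x hx y hy => hE x (Finset.mem_inter.1 hx).1 y (Finset.mem_inter.1 hy).1,
        rfl, rfl, rfl, rfl⟩, fun ha => ?_⟩
    · conv_lhs => rw [hsplit B hB]
      exact hcard _ _ Finset.inter_subset_right Finset.inter_subset_right
    · conv_lhs => rw [hsplit W hW]
      exact hcard _ _ Finset.inter_subset_right Finset.inter_subset_right
    · conv_lhs => rw [hsplit B hB]
      exact Finset.card_union_of_disjoint (hdis B)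
    · conv_lhs => rw [hsplit W hW]
      exact Finset.card_union_of_disjoint (hdis W)
    · rw [Nat.add_eq_zero_iff]
      constructor
      · by_contra hne
        obtain ⟨h1, h2⟩ := mul_ne_zero_iff.1 hne
        obtain ⟨x, hx⟩ := Finset.card_ne_zero.1 h1
        obtain ⟨y, hy⟩ := Finset.card_ne_zero.1 h2
        simp only [Finset.mem_inter] at hx hy
        exact hE x hx.1.1 y hy.1.1 ((hadj x hx.1.2 y hy.1.2).2 ⟨ha, hx.2, hy.2⟩)
      · by_contra hne
        obtain ⟨h1, h2⟩ := mul_ne_zero_iff.1 hne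
        obtain ⟨x, hx⟩ := Finset.card_ne_zero.1 h1
        obtain ⟨y, hy⟩ := Finset.card_ne_zero.1 h2
        simp only [Finset.mem_inter] at hx hy
        exact hE y hy.1.1 x hx.1.1 ((hadj x hx.1.2 y hy.1.2).2 ⟨ha, hx.2, hy.2⟩).symm
  · rintro ⟨_, _, _, _, _, _, _, _, rfl, rfl, rfl, rfl,
      ⟨B₁, W₁, hB₁, hW₁, hd₁, hE₁, rfl, rfl, rfl, rfl⟩,
      ⟨B₂, W₂, hB₂, hW₂, hd₂, hE₂, rfl, rfl, rfl, rfl⟩, ha⟩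
    refine ⟨B₁ ∪ B₂, W₁ ∪ W₂, Finset.union_subset_union hB₁ hB₂, Finset.union_subset_union hW₁ hW₂,
      ?_, ?_, hcard _ _ hB₁ hB₂, hcard _ _ hW₁ hW₂,
      Finset.card_union_of_disjoint (hd.mono hB₁ hB₂),
      Finset.card_union_of_disjoint (hd.mono hW₁ hW₂)⟩
    · rw [Finset.disjoint_union_left, Finset.disjoint_union_right, Finset.disjoint_union_right]
      exact ⟨⟨hd₁, hd.mono hB₁ hW₂⟩, (hd.mono hW₁ hB₂).symm, hd₂⟩
    · intro x hx y hy hxy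
      rw [Finset.mem_union] at hx hy
      rcases hx with hx | hx <;> rcases hy with hy | hy
      · exact hE₁ x hx y hy hxy
      · obtain ⟨ha', hx', hy'⟩ := (hadj x (hB₁ hx) y (hW₂ hy)).1 hxy
        have h0 := (Nat.add_eq_zero_iff.1 (ha ha')).1
        rcases mul_eq_zero.1 h0 with h0 | h0
        · exact Finset.card_ne_zero.2 ⟨x, Finset.mem_inter.2 ⟨hx, hx'⟩⟩ h0
        · exact Finset.card_ne_zero.2 ⟨y, Finset.mem_inter.2 ⟨hy, hy'⟩⟩ h0
      · obtain ⟨ha', hy', hx'⟩ := (hadj y (hW₁ hy) x (hB₂ hx)).1 hxy.symm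
        have h0 := (Nat.add_eq_zero_iff.1 (ha ha')).2
        rcases mul_eq_zero.1 h0 with h0 | h0
        · exact Finset.card_ne_zero.2 ⟨y, Finset.mem_inter.2 ⟨hy, hy'⟩⟩ h0
        · exact Finset.card_ne_zero.2 ⟨x, Finset.mem_inter.2 ⟨hx, hx'⟩⟩ h0
      · exact hE₂ x hx y hy hxy

/-- The vertices fall into clusters `C i`, one for each representative `i` in `S`. Edges between
different clusters run between the boundaries `X i` only: if the representatives are adjacent, all
of these edges are present, and otherwise none. -/
structure IsClustering {V : Type*} [DecidableEq V] (G : SimpleGraph V) (S : Finset V)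
    (C X : V → Finset V) : Prop where
  subset : ∀ i ∈ S, X i ⊆ C i
  disjoint : ∀ i ∈ S, ∀ j ∈ S, i ≠ j → Disjoint (C i) (C j)
  cover : ∀ x, ∃ i ∈ S, x ∈ C i
  adj : ∀ i ∈ S, ∀ j ∈ S, i ≠ j → ∀ x ∈ C i, ∀ y ∈ C j,
    G.Adj x y ↔ G.Adj i j ∧ x ∈ X i ∧ y ∈ X j

theorem isClustering_singletons {V : Type*} [DecidableEq V] [Fintype V] (G : SimpleGraph V) :
    IsClustering G Finset.univ (fun i => {i}) (fun i => {i}) where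
  subset i _ := subset_rfl
  disjoint i _ j _ hij := by simpa using hij
  cover x := ⟨x, by simp⟩
  adj i _ j _ _ x hx y hy := by
    rw [Finset.mem_singleton] at hx hy
    simp [hx, hy]

/-- The kind of a pruning pair: `1` for twins, `0` if `v` has no neighbour except possibly `u`. -/
def IsPruningKind {V : Type*} (G : SimpleGraph V) (S : Finset V) (u v : V) (k : ℕ) : Prop :=
  (k = 1 ∧ ∀ i ∈ S, i ≠ u → i ≠ v → (G.Adj u i ↔ G.Adj v i)) ∨
    (k = 0 ∧ ∀ i ∈ S, i ≠ u → i ≠ v → ¬ G.Adj v i)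

/-- The cluster of `v` can be merged into that of `u` if `u` and `v` form a pruning pair. -/
theorem IsClustering.merge {V : Type*} [DecidableEq V] {G : SimpleGraph V} {S : Finset V}
    {C X : V → Finset V} (h : IsClustering G S C X) {u v : V} (hu : u ∈ S) (hv : v ∈ S)
    (huv : u ≠ v) {k : ℕ} (hk : IsPruningKind G S u v k) :
    IsClustering G (S.erase v) (Function.update C u (C u ∪ C v))
      (Function.update X u (X u ∪ if k = 1 then X v else ∅)) := by
  have hX : ∀ x ∈ (if k = 1 then X v else ∅), x ∈ X v := fun x hx => by
    split_ifs at hx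
    · exact hx
    · simp at hx
  have hcross : ∀ i ∈ S, i ≠ u → i ≠ v → ∀ x ∈ C u ∪ C v, ∀ y ∈ C i,
      (G.Adj x y ↔ G.Adj u i ∧ x ∈ (X u ∪ if k = 1 then X v else ∅) ∧ y ∈ X i) := by
    intro i hi hiu hiv x hx y hy
    rw [Finset.mem_union] at hx ⊢
    have hdis := Finset.disjoint_left.1 (h.disjoint u hu v hv huv)
    rcases hx with hx | hx
    · rw [h.adj u hu i hi hiu.symm x hx y hy]
      have : x ∉ (if k = 1 then X v else ∅) := fun hx' => hdis hx (h.subset v hv (hX x hx'))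
      tauto
    · rw [h.adj v hv i hi hiv.symm x hx y hy]
      have : x ∉ X u := fun hx' => hdis (h.subset u hu hx') hx
      rcases hk with ⟨rfl, hk⟩ | ⟨rfl, hk⟩
      · rw [if_pos rfl, hk i hi hiu hiv]
        tauto
      · have := hk i hi hiu hiv
        simp only [zero_ne_one, if_false, Finset.notMem_empty]
        tauto
  have hdisj : ∀ i ∈ S, i ≠ u → i ≠ v → Disjoint (C u ∪ C v) (C i) := fun i hi hiu hiv => by
    rw [Finset.disjoint_union_left]
    exact ⟨h.disjoint u hu i hi hiu.symm, h.disjoint v hv i hi hiv.symm⟩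
  constructor
  · intro i hi
    obtain ⟨hiv, hi⟩ := Finset.mem_erase.1 hi
    by_cases hiu : i = u
    · subst hiu
      simp only [Function.update_self]
      exact Finset.union_subset_union (h.subset i hi) fun x hx => h.subset v hv (hX x hx)
    · simpa only [Function.update_of_ne hiu] using h.subset i hi
  · intro i hi j hj hij
    obtain ⟨hiv, hi⟩ := Finset.mem_erase.1 hi
    obtain ⟨hjv, hj⟩ := Finset.mem_erase.1 hj
    by_cases hiu : i = u
    · subst hiu
      rw [Function.update_self, Function.update_of_ne hij.symm]
      exact hdisj j hj hij.symm hjv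
    · by_cases hju : j = u
      · subst hju
        rw [Function.update_self, Function.update_of_ne hij]
        exact (hdisj i hi hij hiv).symm
      · rw [Function.update_of_ne hiu, Function.update_of_ne hju]
        exact h.disjoint i hi j hj hij
  · intro x
    obtain ⟨i, hi, hx⟩ := h.cover x
    by_cases hiv : i = v
    · exact ⟨u, Finset.mem_erase.2 ⟨huv, hu⟩, by simp [← hiv, hx]⟩
    · refine ⟨i, Finset.mem_erase.2 ⟨hiv, hi⟩, ?_⟩
      by_cases hiu : i = u
      · rw [hiu] at hx ⊢
        simp [hx]
      · rwa [Function.update_of_ne hiu]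
  · intro i hi j hj hij x hx y hy
    obtain ⟨hiv, hi⟩ := Finset.mem_erase.1 hi
    obtain ⟨hjv, hj⟩ := Finset.mem_erase.1 hj
    by_cases hiu : i = u
    · subst hiu
      rw [Function.update_self] at hx
      rw [Function.update_of_ne hij.symm] at hy
      rw [Function.update_self, Function.update_of_ne hij.symm]
      exact hcross j hj hij.symm hjv x hx y hy
    · by_cases hju : j = u
      · subst hju
        rw [Function.update_self] at hy
        rw [Function.update_of_ne hij] at hx
        rw [Function.update_self, Function.update_of_ne hij, G.adj_comm x y, G.adj_comm i j,
          hcross i hi hij hiv y hy x hx]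
        tauto
      · rw [Function.update_of_ne hiu] at hx
        rw [Function.update_of_ne hju] at hy
        rw [Function.update_of_ne hiu, Function.update_of_ne hju]
        exact h.adj i hi j hj hij x hx y hy

/-- With a single cluster left, its colorings are those of the graph. -/
theorem IsClustering.hasColoring_iff {V : Type*} [DecidableEq V] [Fintype V] {G : SimpleGraph V}
    {i : V} {C X : V → Finset V} (h : IsClustering G {i} C X) {b w : ℕ} :
    HasColoring G b w ↔ ∃ f g, ClusterColoring G (C i) (X i) f g b w := by
  have hC : ∀ B : Finset V, B ⊆ C i := fun B x _ => by
    obtain ⟨j, hj, hx⟩ := h.cover x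
    rwa [Finset.mem_singleton.1 hj] at hx
  constructor
  · rintro ⟨B, W, hd, rfl, rfl, hE⟩
    exact ⟨_, _, B, W, hC B, hC W, hd, hE, rfl, rfl, rfl, rfl⟩
  · rintro ⟨f, g, B, W, -, -, hd, hE, -, -, hb, hw⟩
    exact ⟨B, W, hd, hb, hw, hE⟩

theorem HasColoring.le {V : Type*} [Fintype V] {G : SimpleGraph V} {b w : ℕ}
    (h : HasColoring G b w) : b ≤ Fintype.card V ∧ w ≤ Fintype.card V := by
  obtain ⟨B, W, -, rfl, rfl, -⟩ := h
  exact ⟨Finset.card_le_univ _, Finset.card_le_univ _⟩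

/-! ### The program -/

-- The registers of the program; those from `32` on are left to the compiler.
local notation "reg_n" => (0 : ℕ)
local notation "reg_b" => (1 : ℕ)
local notation "reg_w" => (2 : ℕ)
local notation "reg_radix" => (3 : ℕ)
local notation "reg_count" => (4 : ℕ)
local notation "reg_last" => (5 : ℕ)
local notation "reg_round" => (6 : ℕ)
local notation "reg_i" => (7 : ℕ)
local notation "reg_j" => (8 : ℕ)
local notation "reg_k" => (9 : ℕ)
local notation "reg_twins" => (10 : ℕ)
local notation "reg_pendant" => (11 : ℕ)
local notation "reg_u" => (12 : ℕ)
local notation "reg_v" => (13 : ℕ)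
local notation "reg_kind" => (14 : ℕ)
local notation "reg_adj" => (15 : ℕ)
local notation "reg_s" => (16 : ℕ)
local notation "reg_t" => (17 : ℕ)
local notation "reg_top" => (18 : ℕ)
local notation "reg_f₁" => (19 : ℕ)
local notation "reg_g₁" => (20 : ℕ)
local notation "reg_p₁" => (21 : ℕ)
local notation "reg_q₁" => (22 : ℕ)
local notation "reg_f₂" => (23 : ℕ)
local notation "reg_g₂" => (24 : ℕ)
local notation "reg_p₂" => (25 : ℕ)
local notation "reg_q₂" => (26 : ℕ)
local notation "reg_answer" => (27 : ℕ)

/-- The address of the entry `(f, g, p, q)` of table number `t`: the tables lie behind the adjacency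
matrix and the labels, as numbers in base `2 * n + 2`. Sums of two numbers that are at most `n` are
digits in this base. -/
def tableAddr (n t f g p q : ℕ) : ℕ :=
  n * n + n + ((((t * (2 * n + 2) + f) * (2 * n + 2) + g) * (2 * n + 2) + p) * (2 * n + 2) + q)

namespace Expr

instance : Add Expr := ⟨add⟩
instance : Sub Expr := ⟨sub⟩
instance : Mul Expr := ⟨mul⟩

@[simp] theorem eval_var (σ : State) (r : ℕ) : (var r).eval σ = σ.reg r := rfl
@[simp] theorem eval_num (σ : State) (k : ℕ) : (num k).eval σ = k := rfl
@[simp] theorem eval_add (σ : State) (a b : Expr) : (a + b).eval σ = a.eval σ + b.eval σ := rfl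
@[simp] theorem eval_sub (σ : State) (a b : Expr) : (a - b).eval σ = a.eval σ - b.eval σ := rfl
@[simp] theorem eval_mul (σ : State) (a b : Expr) : (a * b).eval σ = a.eval σ * b.eval σ := rfl
@[simp] theorem eval_load (σ : State) (a : Expr) : (load a).eval σ = σ.mem (a.eval σ) := rfl

/-- The entry of the adjacency matrix for the vertices in two registers. -/
def entry (i j : ℕ) : Expr := load (var i * var reg_n + var j)

/-- The address of the label of the vertex in register `i`. -/
def label (i : ℕ) : Expr := var reg_n * var reg_n + var i

/-- The address of a table entry. -/
def table (t f g p q : Expr) : Expr :=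
  var reg_n * var reg_n + var reg_n +
    ((((t * var reg_radix + f) * var reg_radix + g) * var reg_radix + p) * var reg_radix + q)

/-- Nonzero if and only if the registers `i` and `j` differ. -/
def ne (i j : ℕ) : Expr := (var i - var j) + (var j - var i)

@[simp] theorem eval_entry (σ : State) (i j : ℕ) :
    (entry i j).eval σ = σ.mem (σ.reg i * σ.reg 0 + σ.reg j) := rfl

@[simp] theorem eval_label (σ : State) (i : ℕ) :
    (label i).eval σ = σ.reg 0 * σ.reg 0 + σ.reg i := rfl

theorem eval_table {σ : State} {n : ℕ} (h0 : σ.reg 0 = n) (h3 : σ.reg 3 = 2 * n + 2)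
    (t f g p q : Expr) : (table t f g p q).eval σ =
      tableAddr n (t.eval σ) (f.eval σ) (g.eval σ) (p.eval σ) (q.eval σ) := by
  simp [table, tableAddr, h0, h3]

theorem eval_ne (σ : State) (i j : ℕ) : (ne i j).eval σ = 0 ↔ σ.reg i = σ.reg j := by
  simp [ne]
  omega

end Expr

namespace Cmd

open BWColoring.Expr

/-- Every vertex gets a table of its own, for the cluster that consists of this vertex, and its
label is the number of this table plus one. -/
def setup : Cmd :=
  .seq (assign reg_radix (num 2 * var reg_n + num 2))
  (.seq (assign reg_count (var reg_n + num 1))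
  (.seq (assign reg_last (var reg_n - num 1))
  (.seq (assign reg_top (num 0))
  (loop reg_i reg_n
    (.seq (store (label reg_i) (var reg_i + num 1))
    (.seq (store (table (var reg_i) (num 0) (num 0) (num 0) (num 0)) (num 1))
    (.seq (store (table (var reg_i) (num 1) (num 0) (num 1) (num 0)) (num 1))
      (store (table (var reg_i) (num 0) (num 1) (num 0) (num 1)) (num 1)))))))))

/-- Check whether the vertices `i` and `j` are twins among the representatives, and whether `j` has
no neighbour among them except possibly `i`. -/
def inspect : Cmd :=
  .seq (assign reg_twins (num 1))
  (.seq (assign reg_pendant (num 1))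
  (loop reg_k reg_n
    (ite (num 0) (load (label reg_k) * (ne reg_i reg_k * ne reg_j reg_k))
      (.seq (assign reg_twins (var reg_twins *
          (num 1 - ((entry reg_i reg_k - entry reg_j reg_k) +
            (entry reg_j reg_k - entry reg_i reg_k)))))
        (assign reg_pendant (var reg_pendant * (num 1 - entry reg_j reg_k))))
      skip)))

/-- Search for a pruning pair. -/
def search : Cmd :=
  nest [reg_i, reg_j] reg_n
    (ite (num 0) (load (label reg_i) * (load (label reg_j) * ne reg_i reg_j))
      (.seq inspect
        (ite (num 0) (var reg_twins + var reg_pendant)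
          (.seq (assign reg_u (var reg_i))
          (.seq (assign reg_v (var reg_j))
            (assign reg_kind (var reg_twins))))
          skip))
      skip)

/-- Compute a new table from those of two clusters. -/
def combine : Cmd :=
  nest [reg_f₁, reg_g₁, reg_p₁, reg_q₁, reg_f₂, reg_g₂, reg_p₂, reg_q₂] reg_count
    (ite (var reg_adj * (var reg_f₁ * var reg_g₂ + var reg_g₁ * var reg_f₂))
      (load (table (var reg_s) (var reg_f₁) (var reg_g₁) (var reg_p₁) (var reg_q₁)) *
        load (table (var reg_t) (var reg_f₂) (var reg_g₂) (var reg_p₂) (var reg_q₂)))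
      (store (table (var reg_n + var reg_round)
        (var reg_f₁ + var reg_kind * var reg_f₂) (var reg_g₁ + var reg_kind * var reg_g₂)
        (var reg_p₁ + var reg_p₂) (var reg_q₁ + var reg_q₂)) (num 1))
      skip)

/-- Merge the cluster of `v` into the cluster of `u`. -/
def merge : Cmd :=
  .seq (assign reg_adj (entry reg_u reg_v))
  (.seq (assign reg_s (load (label reg_u) - num 1))
  (.seq (assign reg_t (load (label reg_v) - num 1))
  (.seq combine
  (.seq (store (label reg_u) (var reg_n + var reg_round + num 1))
  (.seq (store (label reg_v) (num 0))
    (assign reg_top (var reg_n + var reg_round)))))))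

/-- Look up the answer in the table of the last cluster. -/
def lookup : Cmd :=
  .seq (assign reg_answer (num 0))
  (.seq (nest [reg_i, reg_j] reg_count
    (ite (num 0) (load (table (var reg_top) (var reg_i) (var reg_j) (var reg_b) (var reg_w)))
      (assign reg_answer (num 1)) skip))
    (assign reg_n (var reg_answer)))

/-- The whole algorithm. Numbers `b` and `w` above `n` and the empty graph are treated separately,
since `b` and `w` have to be digits and an empty graph has no cluster to look up. After `n - 1`
rounds a single cluster is left. -/
def solve : Cmd :=
  ite (var reg_b) (var reg_n + num 1)
    (ite (var reg_w) (var reg_n + num 1)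
      (ite (num 0) (var reg_n)
        (.seq setup (.seq (loop reg_round reg_last (.seq search merge)) lookup))
        (assign reg_n (num 1)))
      (assign reg_n (num 0)))
    (assign reg_n (num 0))

theorem solve_wf : solve.wf 64 = true := by decide

theorem solve_depth : solve.compile.depth ≤ 9 := by decide +kernel

end Cmd

/-! ### Memory layout -/

theorem digit_inj {D a b x y : ℕ} (hx : x < D) (hy : y < D) :
    a * D + x = b * D + y ↔ a = b ∧ x = y := by
  constructor
  · intro h
    have h1 : (a * D + x) / D = a := by
      rw [mul_comm, Nat.mul_add_div (by omega), Nat.div_eq_of_lt hx, add_zero]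
    have h2 : (b * D + y) / D = b := by
      rw [mul_comm, Nat.mul_add_div (by omega), Nat.div_eq_of_lt hy, add_zero]
    have h3 : a = b := by rw [← h1, ← h2, h]
    subst h3
    exact ⟨rfl, by omega⟩
  · rintro ⟨rfl, rfl⟩
    rfl

theorem tableAddr_inj {n t f g p q t' f' g' p' q' : ℕ} (hf : f < 2 * n + 2) (hg : g < 2 * n + 2)
    (hp : p < 2 * n + 2) (hq : q < 2 * n + 2) (hf' : f' < 2 * n + 2) (hg' : g' < 2 * n + 2)
    (hp' : p' < 2 * n + 2) (hq' : q' < 2 * n + 2) :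
    tableAddr n t f g p q = tableAddr n t' f' g' p' q' ↔
      t = t' ∧ f = f' ∧ g = g' ∧ p = p' ∧ q = q' := by
  rw [tableAddr, tableAddr, add_right_inj, digit_inj hq hq', digit_inj hp hp', digit_inj hg hg',
    digit_inj hf hf']
  tauto

theorem le_tableAddr (n t f g p q : ℕ) : n * n + n ≤ tableAddr n t f g p q :=
  Nat.le_add_right _ _

/-- The memory `m` holds the adjacency matrix `E`, the labels `A` and the tables `T`. -/
structure Layout (n : ℕ) (m E A : ℕ → ℕ) (T : ℕ → ℕ → ℕ → ℕ → ℕ → ℕ) : Prop where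
  adj : ∀ a < n * n, m a = E a
  label : ∀ i < n, m (n * n + i) = A i
  table : ∀ t f g p q, f < 2 * n + 2 → g < 2 * n + 2 → p < 2 * n + 2 → q < 2 * n + 2 →
    m (tableAddr n t f g p q) = T t f g p q

theorem Layout.setLabel {n : ℕ} {σ : State} {E A : ℕ → ℕ} {T : ℕ → ℕ → ℕ → ℕ → ℕ → ℕ}
    (h : Layout n σ.mem E A T) {i : ℕ} (hi : i < n) (v : ℕ) :
    Layout n (σ.setMem (n * n + i) v).mem E (Function.update A i v) T where
  adj a ha := by
    rw [State.setMem_mem, if_neg (by omega), h.adj a ha]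
  label j hj := by
    rw [State.setMem_mem, Function.update_apply, h.label j hj]
    simp
  table t f g p q hf hg hp hq := by
    have := le_tableAddr n t f g p q
    rw [State.setMem_mem, if_neg (by omega), h.table t f g p q hf hg hp hq]

theorem Layout.setTable {n : ℕ} {σ : State} {E A : ℕ → ℕ} {T : ℕ → ℕ → ℕ → ℕ → ℕ → ℕ}
    (h : Layout n σ.mem E A T) {t f g p q : ℕ} (hf : f < 2 * n + 2) (hg : g < 2 * n + 2)
    (hp : p < 2 * n + 2) (hq : q < 2 * n + 2) (v : ℕ) :
    Layout n (σ.setMem (tableAddr n t f g p q) v).mem E A fun t' f' g' p' q' =>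
      if t' = t ∧ f' = f ∧ g' = g ∧ p' = p ∧ q' = q then v else T t' f' g' p' q' where
  adj a ha := by
    have := le_tableAddr n t f g p q
    rw [State.setMem_mem, if_neg (by omega), h.adj a ha]
  label j hj := by
    have := le_tableAddr n t f g p q
    rw [State.setMem_mem, if_neg (by omega), h.label j hj]
  table t' f' g' p' q' hf' hg' hp' hq' := by
    rw [State.setMem_mem, h.table t' f' g' p' q' hf' hg' hp' hq']
    exact if_congr (tableAddr_inj hf' hg' hp' hq' hf hg hp hq) rfl rfl

/-! ### Correctness of the search -/

/-- `x` is the truth value of `P`. -/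
def Indicates (x : ℕ) (P : Prop) : Prop :=
  (P → x = 1) ∧ (¬ P → x = 0)

namespace Indicates

variable {x y : ℕ} {P Q : Prop}

theorem congr (h : Indicates x P) (hPQ : P ↔ Q) : Indicates x Q := by
  rwa [Indicates, ← hPQ]

theorem le_one (h : Indicates x P) : x ≤ 1 := by
  by_cases hP : P
  · rw [h.1 hP]
  · rw [h.2 hP]; exact zero_le_one

theorem pos_iff (h : Indicates x P) : 0 < x ↔ P := by
  by_cases hP : P
  · simp [h.1 hP, hP]
  · simp [h.2 hP, hP]

theorem mul (hx : Indicates x P) (hy : Indicates y Q) : Indicates (x * y) (P ∧ Q) := by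
  by_cases hP : P <;> by_cases hQ : Q <;> simp [Indicates, hP, hQ, hx.1, hx.2, hy.1, hy.2]

theorem not (hx : Indicates x P) : Indicates (1 - x) (¬ P) := by
  by_cases hP : P <;> simp [Indicates, hP, hx.1, hx.2]

theorem iff (hx : Indicates x P) (hy : Indicates y Q) :
    Indicates (1 - ((x - y) + (y - x))) (P ↔ Q) := by
  by_cases hP : P <;> by_cases hQ : Q <;> simp [Indicates, hP, hQ, hx.1, hx.2, hy.1, hy.2]

end Indicates

theorem entry_lt {n : ℕ} (i j : Fin n) : (i : ℕ) * n + j < n * n := by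
  have h1 : ((i : ℕ) + 1) * n ≤ n * n := Nat.mul_le_mul_right _ i.2
  have h2 := j.2
  rw [add_mul, one_mul] at h1
  omega

/-- The labels of the representatives are positive, and all others are zero. -/
def Labels {n : ℕ} (S : Finset (Fin n)) (A : ℕ → ℕ) : Prop :=
  ∀ i : Fin n, 0 < A i ↔ i ∈ S

/-- `E` is the adjacency matrix of `G`, stored row by row. -/
def IsAdjMatrix {n : ℕ} (G : SimpleGraph (Fin n)) (E : ℕ → ℕ) : Prop :=
  ∀ i j : Fin n, Indicates (E (i * n + j)) (G.Adj i j)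

namespace Cmd

variable {n X N : ℕ} {G : SimpleGraph (Fin n)} {S : Finset (Fin n)} {E A : ℕ → ℕ}
  {T : ℕ → ℕ → ℕ → ℕ → ℕ → ℕ} {σ : State}

theorem forall_lt_succ_iff {k : Fin n} {P : Fin n → Prop} :
    (∀ l ∈ S, (l : ℕ) < k + 1 → P l) ↔ (∀ l ∈ S, (l : ℕ) < k → P l) ∧ (k ∈ S → P k) := by
  constructor
  · exact fun h => ⟨fun l hl hlk => h l hl (by omega), fun hk => h k hk (by omega)⟩
  · rintro ⟨h1, h2⟩ l hl hlk
    rcases Nat.lt_succ_iff_lt_or_eq.1 hlk with h | h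
    · exact h1 l hl h
    · obtain rfl := Fin.ext h
      exact h2 hl

theorem wp_inspect (hL : Layout n σ.mem E A T) (hE : IsAdjMatrix G E) (hA : Labels S A)
    (hX : 1 ≤ X) (hN : n ≤ N) (h0 : σ.reg 0 = n) {i j : Fin n} (hi : σ.reg 7 = i)
    (hj : σ.reg 8 = j) :
    WP X N inspect (fun τ =>
      Indicates (τ.reg 10) (∀ k ∈ S, k ≠ i → k ≠ j → (G.Adj i k ↔ G.Adj j k)) ∧
      Indicates (τ.reg 11) (∀ k ∈ S, k ≠ i → k ≠ j → ¬ G.Adj j k)) σ := by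
  rw [inspect, wp_seq, wp_assign, wp_seq, wp_assign]
  refine ⟨by simpa, by simpa, wp_loop (fun m τ => τ.mem = σ.mem ∧
      Indicates (τ.reg 10) (∀ k ∈ S, (k : ℕ) < m → k ≠ i → k ≠ j → (G.Adj i k ↔ G.Adj j k)) ∧
      Indicates (τ.reg 11) (∀ k ∈ S, (k : ℕ) < m → k ≠ i → k ≠ j → ¬ G.Adj j k))
    (by simpa [h0]) (by simp [Indicates]) ?_ ?_⟩
  · intro m hm τ hτ ⟨hmem, htw, hpe⟩
    have hτ0 : τ.reg 0 = n := by rw [hτ 0 (by decide)]; simp [h0]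
    have hτ7 : τ.reg 7 = i := by rw [hτ 7 (by decide)]; simp [hi]
    have hτ8 : τ.reg 8 = j := by rw [hτ 8 (by decide)]; simp [hj]
    have hm' : m < n := by simpa [h0] using hm
    obtain ⟨k, rfl⟩ : ∃ k : Fin n, (k : ℕ) = m := ⟨⟨m, hm'⟩, rfl⟩
    have hik := (hE i k).congr Iff.rfl
    have hjk := (hE j k).congr Iff.rfl
    rw [← hL.adj _ (entry_lt i k), ← hmem] at hik
    rw [← hL.adj _ (entry_lt j k), ← hmem] at hjk
    have hlab : τ.mem (n * n + k) = A k := by rw [hmem, hL.label k k.2]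
    have hcond : (Expr.eval (τ.setReg 9 k) (.num 0) <
        Expr.eval (τ.setReg 9 k) (.load (.label 9) * (.ne 7 9 * .ne 8 9))) ↔
          k ∈ S ∧ k ≠ i ∧ k ≠ j := by
      rw [Expr.eval_num, Nat.pos_iff_ne_zero, Expr.eval_mul, Expr.eval_mul, mul_ne_zero_iff,
        mul_ne_zero_iff, Ne, Ne, Ne, Expr.eval_ne, Expr.eval_ne, ← hA k, Nat.pos_iff_ne_zero,
        Fin.ne_iff_vne, Fin.ne_iff_vne]
      simp only [Expr.eval_load, Expr.eval_label, State.setReg_reg, State.setReg_mem]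
      norm_num [hτ0, hτ7, hτ8, hlab]
      tauto
    rw [wp_ite, hcond]
    refine ⟨fun hc => ?_, fun hc => ?_⟩
    · rw [wp_seq, wp_assign, wp_assign]
      have h1 := (htw.mul (hik.iff hjk)).congr (Q := ∀ l ∈ S, (l : ℕ) < k + 1 → l ≠ i → l ≠ j →
        (G.Adj i l ↔ G.Adj j l)) (by rw [forall_lt_succ_iff]; tauto)
      have h2 := (hpe.mul hjk.not).congr (Q := ∀ l ∈ S, (l : ℕ) < k + 1 → l ≠ i → l ≠ j →
        ¬ G.Adj j l) (by rw [forall_lt_succ_iff]; tauto)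
      simp only [Expr.eval_mul, Expr.eval_sub, Expr.eval_add, Expr.eval_var, Expr.eval_num,
        Expr.eval_entry, State.setReg_reg, State.setReg_mem, Nat.reduceEqDiff, reduceIte,
        OfNat.zero_ne_ofNat, hτ0, hτ7, hτ8]
      exact ⟨h1.le_one.trans hX, h2.le_one.trans hX, hmem, h1, h2⟩
    · rw [wp_skip]
      refine ⟨hmem, htw.congr ?_, hpe.congr ?_⟩ <;> rw [forall_lt_succ_iff]
      · exact (and_iff_left fun h1 h2 h3 => absurd ⟨h1, h2, h3⟩ hc).symm
      · exact (and_iff_left fun h1 h2 h3 => absurd ⟨h1, h2, h3⟩ hc).symm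
  · rintro τ hτ ⟨-, htw, hpe⟩
    simp only [State.setReg_reg, h0] at htw hpe ⊢
    norm_num at htw hpe ⊢
    exact ⟨htw, hpe⟩

/-- If there is a pruning pair, then the search leaves one in the registers `u`, `v`, together with
its kind. -/
theorem wp_search (hL : Layout n σ.mem E A T) (hE : IsAdjMatrix G E) (hA : Labels S A)
    (hX : n ≤ X) (hN : n ≤ N) (h0 : σ.reg 0 = n)
    (hex : ∃ i ∈ S, ∃ j ∈ S, i ≠ j ∧ IsPruningPair G S i j) :
    WP X N search (fun τ => ∃ u ∈ S, ∃ v ∈ S, u ≠ v ∧ IsPruningKind G S u v (τ.reg 14) ∧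
      τ.reg 12 = u ∧ τ.reg 13 = v) σ := by
  have hX1 : 1 ≤ X := by
    obtain ⟨i, -⟩ := hex
    have := i.2
    omega
  refine (wp_nest [7, 8] (by decide) (by decide) (by decide) (by decide) n hN
    (fun D τ => τ.mem = σ.mem ∧ τ.reg 0 = n ∧
      ((∃ i ∈ S, ∃ j ∈ S, i ≠ j ∧ IsPruningPair G S i j ∧ [(i : ℕ), (j : ℕ)] ∈ D) →
        ∃ u ∈ S, ∃ v ∈ S, u ≠ v ∧ IsPruningKind G S u v (τ.reg 14) ∧
          τ.reg 12 = u ∧ τ.reg 13 = v)) ?_ ?_ ∅ σ h0 ⟨rfl, h0, by simp⟩).mono ?_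
  · rintro D τ x v hx ⟨h1, h2, h3⟩
    have hx : x = 7 ∨ x = 8 := by simpa using hx
    rcases hx with rfl | rfl <;> exact ⟨h1, by simpa using h2, by simpa using h3⟩
  · rintro D τ ⟨hmem, h0, h3⟩ hlt
    obtain ⟨i, hi⟩ : ∃ i : Fin n, (i : ℕ) = τ.reg 7 := ⟨⟨τ.reg 7, hlt 7 (by simp)⟩, rfl⟩
    obtain ⟨j, hj⟩ : ∃ j : Fin n, (j : ℕ) = τ.reg 8 := ⟨⟨τ.reg 8, hlt 8 (by simp)⟩, rfl⟩
    have hi' := hL.label i i.2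
    have hj' := hL.label j j.2
    have hcond : (Expr.eval τ (.num 0) <
        Expr.eval τ (.load (.label 7) * (.load (.label 8) * .ne 7 8))) ↔
          i ∈ S ∧ j ∈ S ∧ i ≠ j := by
      rw [Expr.eval_num, Nat.pos_iff_ne_zero, Expr.eval_mul, Expr.eval_mul, mul_ne_zero_iff,
        mul_ne_zero_iff, Ne, Ne, Ne, Expr.eval_ne, ← hA i, ← hA j, Nat.pos_iff_ne_zero,
        Nat.pos_iff_ne_zero, Fin.ne_iff_vne]
      simp only [Expr.eval_load, Expr.eval_label, hmem, h0, ← hi, ← hj, hi', hj']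
    have hmap : ([7, 8] : List ℕ).map τ.reg = [(i : ℕ), (j : ℕ)] := by simp [hi, hj]
    rw [hmap]
    -- A pair that is already done, or else the current one.
    have hins : ∀ a b : Fin n, [(a : ℕ), (b : ℕ)] ∈ insert [(i : ℕ), (j : ℕ)] D ↔
        (a = i ∧ b = j) ∨ [(a : ℕ), (b : ℕ)] ∈ D := fun a b => by
      simp [Fin.ext_iff]
    rw [wp_ite, hcond]
    refine ⟨fun hc => ?_, fun hc => ?_⟩
    · rw [wp_seq]
      refine ((wp_inspect (hmem ▸ hL) hE hA hX1 hN h0 hi.symm hj.symm).mem_eq rfl).frame ?_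
      rintro υ hυ ⟨hmem', htw, hpe⟩
      have hυ0 : υ.reg 0 = n := by rw [hυ 0 (by decide), h0]
      have hυ7 : υ.reg 7 = i := by rw [hυ 7 (by decide), hi]
      have hυ8 : υ.reg 8 = j := by rw [hυ 8 (by decide), hj]
      have hpr : 0 < υ.reg 10 + υ.reg 11 ↔ IsPruningPair G S i j := by
        rw [Nat.add_pos_iff_pos_or_pos, htw.pos_iff, hpe.pos_iff]
        rfl
      rw [wp_ite, Expr.eval_num, Expr.eval_add, Expr.eval_var, Expr.eval_var, hpr]
      refine ⟨fun hp => ?_, fun hp => ?_⟩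
      · rw [wp_seq, wp_assign, wp_seq, wp_assign, wp_assign]
        have h1 := i.2
        have h2 := j.2
        simp only [Expr.eval_var, State.setReg_reg, State.setReg_mem, Nat.reduceEqDiff, reduceIte,
          OfNat.zero_ne_ofNat, hυ7, hυ8]
        refine ⟨by omega, by omega, htw.le_one.trans hX1, hmem'.trans hmem, hυ0, fun _ =>
          ⟨i, hc.1, j, hc.2.1, hc.2.2, ?_, rfl, rfl⟩⟩
        by_cases htwins : ∀ k ∈ S, k ≠ i → k ≠ j → (G.Adj i k ↔ G.Adj j k)
        · exact Or.inl ⟨htw.1 htwins, htwins⟩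
        · exact Or.inr ⟨htw.2 htwins, hp.resolve_left htwins⟩
      · rw [wp_skip]
        refine ⟨hmem'.trans hmem, hυ0, ?_⟩
        rintro ⟨a, ha, b, hb, hab, hab', hD⟩
        rcases (hins a b).1 hD with ⟨rfl, rfl⟩ | hD
        · exact absurd hab' hp
        · rw [hυ 14 (by decide), hυ 12 (by decide), hυ 13 (by decide)]
          exact h3 ⟨a, ha, b, hb, hab, hab', hD⟩
    · rw [wp_skip]
      refine ⟨hmem, h0, ?_⟩
      rintro ⟨a, ha, b, hb, hab, hab', hD⟩
      rcases (hins a b).1 hD with ⟨rfl, rfl⟩ | hD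
      · exact absurd ⟨ha, hb, hab⟩ hc
      · exact h3 ⟨a, ha, b, hb, hab, hab', hD⟩
  · rintro τ ⟨-, -, h3⟩
    obtain ⟨i, hi, j, hj, hij, hp⟩ := hex
    exact h3 ⟨i, hi, j, hj, hij, hp, by simp⟩

end Cmd

/-! ### Correctness of the merging of clusters -/

theorem Indicates.mul_lt_iff {x y m : ℕ} {P Q : Prop} (hx : Indicates x P) (hy : Indicates y Q) :
    y * m < x ↔ P ∧ (Q → m = 0) := by
  by_cases hP : P <;> by_cases hQ : Q <;> simp [hP, hQ, hx.1, hx.2, hy.1, hy.2]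

/-- The memory content stands for a clustering with representatives `S`, clusters `C` and
boundaries `Y`, reached after `r` rounds: the label of a representative is the number of its table
plus one, this table lists the colorings of the cluster, and the tables from `n + r` on are empty. -/
structure Represents {n : ℕ} (G : SimpleGraph (Fin n)) (r : ℕ) (S : Finset (Fin n))
    (C Y : Fin n → Finset (Fin n)) (A : ℕ → ℕ) (T : ℕ → ℕ → ℕ → ℕ → ℕ → ℕ) : Prop where
  clustering : IsClustering G S C Y
  card : S.card + r = n
  labels : Labels S A
  label_le : ∀ i ∈ S, A i ≤ n + r
  table : ∀ i ∈ S, ∀ f g p q, f < 2 * n + 2 → g < 2 * n + 2 → p < 2 * n + 2 → q < 2 * n + 2 →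
    Indicates (T (A i - 1) f g p q) (ClusterColoring G (C i) (Y i) f g p q)
  fresh : ∀ t, n + r ≤ t → ∀ f g p q, f < 2 * n + 2 → g < 2 * n + 2 → p < 2 * n + 2 →
    q < 2 * n + 2 → T t f g p q = 0

namespace Cmd

variable {n X N : ℕ} {G : SimpleGraph (Fin n)} {S : Finset (Fin n)} {E A : ℕ → ℕ}
  {T : ℕ → ℕ → ℕ → ℕ → ℕ → ℕ} {σ : State}

/-- The loop over all pairs of entries of the tables `s` and `t` writes ones at the sums of those
pairs that are compatible. -/
theorem wp_combine {F₁ F₂ : ℕ → ℕ → ℕ → ℕ → Prop} {a : Prop} {k r s t : ℕ}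
    (hL : Layout n σ.mem E A T) (hX : 1 ≤ X) (hN : n + 1 ≤ N) (h0 : σ.reg 0 = n)
    (h3 : σ.reg 3 = 2 * n + 2) (h4 : σ.reg 4 = n + 1) (h6 : σ.reg 6 = r) (h14 : σ.reg 14 = k)
    (hk : k = 0 ∨ k = 1) (h15 : Indicates (σ.reg 15) a) (h16 : σ.reg 16 = s) (h17 : σ.reg 17 = t)
    (hs : s < n + r) (ht : t < n + r)
    (hF₁ : ∀ f g p q, f < n + 1 → g < n + 1 → p < n + 1 → q < n + 1 →
      Indicates (T s f g p q) (F₁ f g p q))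
    (hF₂ : ∀ f g p q, f < n + 1 → g < n + 1 → p < n + 1 → q < n + 1 →
      Indicates (T t f g p q) (F₂ f g p q))
    (hfresh : ∀ f g p q, f < 2 * n + 2 → g < 2 * n + 2 → p < 2 * n + 2 → q < 2 * n + 2 →
      T (n + r) f g p q = 0) :
    WP X N combine (fun τ => ∃ T', Layout n τ.mem E A T' ∧ (∀ t', t' ≠ n + r → T' t' = T t') ∧
      ∀ f g p q, f < 2 * n + 2 → g < 2 * n + 2 → p < 2 * n + 2 → q < 2 * n + 2 →
        Indicates (T' (n + r) f g p q) (∃ f₁ g₁ p₁ q₁ f₂ g₂ p₂ q₂,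
          (∀ v ∈ [f₁, g₁, p₁, q₁, f₂, g₂, p₂, q₂], v < n + 1) ∧
          f = f₁ + k * f₂ ∧ g = g₁ + k * g₂ ∧ p = p₁ + p₂ ∧ q = q₁ + q₂ ∧
          F₁ f₁ g₁ p₁ q₁ ∧ F₂ f₂ g₂ p₂ q₂ ∧ (a → f₁ * g₂ + g₁ * f₂ = 0))) σ := by
  refine (wp_nest [19, 20, 21, 22, 23, 24, 25, 26] (by decide) (by decide) (by decide) (by decide)
    (n + 1) hN (fun D τ => (∀ x ∈ [0, 3, 6, 14, 15, 16, 17], τ.reg x = σ.reg x) ∧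
      ∃ T', Layout n τ.mem E A T' ∧ (∀ t', t' ≠ n + r → T' t' = T t') ∧
      ∀ f g p q, f < 2 * n + 2 → g < 2 * n + 2 → p < 2 * n + 2 → q < 2 * n + 2 →
        Indicates (T' (n + r) f g p q) (∃ f₁ g₁ p₁ q₁ f₂ g₂ p₂ q₂,
          [f₁, g₁, p₁, q₁, f₂, g₂, p₂, q₂] ∈ D ∧
          f = f₁ + k * f₂ ∧ g = g₁ + k * g₂ ∧ p = p₁ + p₂ ∧ q = q₁ + q₂ ∧
          F₁ f₁ g₁ p₁ q₁ ∧ F₂ f₂ g₂ p₂ q₂ ∧ (a → f₁ * g₂ + g₁ * f₂ = 0))) ?_ ?_ ∅ σ h4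
    ⟨fun _ _ => rfl, T, hL, fun _ _ => rfl, fun f g p q hf hg hp hq => ?_⟩).mono ?_
  · rintro D τ x v hx ⟨h1, h2⟩
    refine ⟨fun y hy => ?_, h2⟩
    have hne : y ≠ x := by
      rintro rfl
      revert hx
      revert y
      decide
    rw [State.setReg_reg, if_neg hne, h1 y hy]
  · rintro D τ ⟨hreg, T', hL', hT', hD⟩ hlt
    simp only [List.mem_cons, List.not_mem_nil, or_false, forall_eq_or_imp, forall_eq] at hlt
    obtain ⟨hf₁, hg₁, hp₁, hq₁, hf₂, hg₂, hp₂, hq₂⟩ := hlt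
    simp only [List.map_cons, List.map_nil]
    have hτ0 : τ.reg 0 = n := (hreg 0 (by simp)).trans h0
    have hτ3 : τ.reg 3 = 2 * n + 2 := (hreg 3 (by simp)).trans h3
    have hτ6 : τ.reg 6 = r := (hreg 6 (by simp)).trans h6
    have hτ14 : τ.reg 14 = k := (hreg 14 (by simp)).trans h14
    have hτ15 : Indicates (τ.reg 15) a := by rw [hreg 15 (by simp)]; exact h15
    have hτ16 : τ.reg 16 = s := (hreg 16 (by simp)).trans h16
    have hτ17 : τ.reg 17 = t := (hreg 17 (by simp)).trans h17
    obtain ⟨f₁, e₁⟩ : ∃ v, τ.reg 19 = v := ⟨_, rfl⟩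
    obtain ⟨g₁, e₂⟩ : ∃ v, τ.reg 20 = v := ⟨_, rfl⟩
    obtain ⟨p₁, e₃⟩ : ∃ v, τ.reg 21 = v := ⟨_, rfl⟩
    obtain ⟨q₁, e₄⟩ : ∃ v, τ.reg 22 = v := ⟨_, rfl⟩
    obtain ⟨f₂, e₅⟩ : ∃ v, τ.reg 23 = v := ⟨_, rfl⟩
    obtain ⟨g₂, e₆⟩ : ∃ v, τ.reg 24 = v := ⟨_, rfl⟩
    obtain ⟨p₂, e₇⟩ : ∃ v, τ.reg 25 = v := ⟨_, rfl⟩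
    obtain ⟨q₂, e₈⟩ : ∃ v, τ.reg 26 = v := ⟨_, rfl⟩
    rw [e₁] at hf₁
    rw [e₂] at hg₁
    rw [e₃] at hp₁
    rw [e₄] at hq₁
    rw [e₅] at hf₂
    rw [e₆] at hg₂
    rw [e₇] at hp₂
    rw [e₈] at hq₂
    rw [e₁, e₂, e₃, e₄, e₅, e₆, e₇, e₈]
    have hcond : Expr.eval τ (.var 15 * (.var 19 * .var 24 + .var 20 * .var 23)) <
        Expr.eval τ (.load (.table (.var 16) (.var 19) (.var 20) (.var 21) (.var 22)) *
          .load (.table (.var 17) (.var 23) (.var 24) (.var 25) (.var 26))) ↔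
        (F₁ f₁ g₁ p₁ q₁ ∧ F₂ f₂ g₂ p₂ q₂) ∧ (a → f₁ * g₂ + g₁ * f₂ = 0) := by
      simp only [Expr.eval_mul, Expr.eval_load, Expr.eval_table hτ0 hτ3, Expr.eval_add,
        Expr.eval_var, e₁, e₂, e₃, e₄, e₅, e₆, e₇, e₈, hτ16, hτ17]
      rw [hL'.table, hL'.table, hT' s (by omega), hT' t (by omega)]
      · exact ((hF₁ _ _ _ _ hf₁ hg₁ hp₁ hq₁).mul (hF₂ _ _ _ _ hf₂ hg₂ hp₂ hq₂)).mul_lt_iff hτ15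
      all_goals omega
    rw [wp_ite, hcond]
    refine ⟨fun hc => ?_, fun hc => ?_⟩
    · have hf : f₁ + k * f₂ < 2 * n + 2 := by rcases hk with rfl | rfl <;> omega
      have hg : g₁ + k * g₂ < 2 * n + 2 := by rcases hk with rfl | rfl <;> omega
      have hp : p₁ + p₂ < 2 * n + 2 := by omega
      have hq : q₁ + q₂ < 2 * n + 2 := by omega
      rw [wp_store]
      refine ⟨by simpa using hX, hreg, ?_⟩
      simp only [Expr.eval_table hτ0 hτ3, Expr.eval_add, Expr.eval_mul,
        Expr.eval_var, Expr.eval_num, e₁, e₂, e₃, e₄, e₅, e₆, e₇, e₈, hτ0, hτ6, hτ14]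
      refine ⟨_, hL'.setTable hf hg hp hq 1, ?_, ?_⟩
      · intro t' ht'
        funext f' g' p' q'
        rw [if_neg (fun h => ht' h.1), hT' t' ht']
      · intro f' g' p' q' hf' hg' hp' hq'
        split_ifs with h
        · obtain ⟨-, rfl, rfl, rfl, rfl⟩ := h
          exact ⟨fun _ => rfl, fun h => absurd ⟨_, _, _, _, _, _, _, _, Set.mem_insert _ _,
            rfl, rfl, rfl, rfl, hc.1.1, hc.1.2, hc.2⟩ h⟩
        · refine (hD f' g' p' q' hf' hg' hp' hq').congr ⟨?_, ?_⟩
          · rintro ⟨_, _, _, _, _, _, _, _, h1, h2⟩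
            exact ⟨_, _, _, _, _, _, _, _, Set.mem_insert_of_mem _ h1, h2⟩
          · rintro ⟨_, _, _, _, _, _, _, _, h1, h2⟩
            rcases h1 with h1 | h1
            · simp only [List.cons.injEq, and_true] at h1
              obtain ⟨rfl, rfl, rfl, rfl, rfl, rfl, rfl, rfl⟩ := h1
              exact absurd ⟨rfl, h2.1, h2.2.1, h2.2.2.1, h2.2.2.2.1⟩ h
            · exact ⟨_, _, _, _, _, _, _, _, h1, h2⟩
    · rw [wp_skip]
      refine ⟨hreg, T', hL', hT', fun f' g' p' q' hf' hg' hp' hq' => ?_⟩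
      refine (hD f' g' p' q' hf' hg' hp' hq').congr ⟨?_, ?_⟩
      · rintro ⟨_, _, _, _, _, _, _, _, h1, h2⟩
        exact ⟨_, _, _, _, _, _, _, _, Set.mem_insert_of_mem _ h1, h2⟩
      · rintro ⟨_, _, _, _, _, _, _, _, h1, h2⟩
        rcases h1 with h1 | h1
        · simp only [List.cons.injEq, and_true] at h1
          obtain ⟨rfl, rfl, rfl, rfl, rfl, rfl, rfl, rfl⟩ := h1
          exact absurd ⟨⟨h2.2.2.2.2.1, h2.2.2.2.2.2.1⟩, h2.2.2.2.2.2.2⟩ hc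
        · exact ⟨_, _, _, _, _, _, _, _, h1, h2⟩
  · simp [Indicates, hfresh f g p q hf hg hp hq]
  · rintro τ ⟨-, T', hL', hT', hD⟩
    refine ⟨T', hL', hT', fun f g p q hf hg hp hq => (hD f g p q hf hg hp hq).congr ?_⟩
    simp only [Set.empty_union, Set.mem_ofPred_eq, List.length_cons, List.length_nil, true_and]

/-- Merging the cluster of `v` into that of `u` leads to a clustering with one representative less,
whose newest table has the number in register `top`. -/
theorem wp_merge {C Y : Fin n → Finset (Fin n)} {r k : ℕ} {u v : Fin n}
    (hL : Layout n σ.mem E A T) (hE : IsAdjMatrix G E) (hR : Represents G r S C Y A T)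
    (hX : 2 * n + 2 ≤ X) (hN : n + 1 ≤ N) (h0 : σ.reg 0 = n) (h3 : σ.reg 3 = 2 * n + 2)
    (h4 : σ.reg 4 = n + 1) (h6 : σ.reg 6 = r) (hu : u ∈ S) (hv : v ∈ S) (huv : u ≠ v)
    (hk : IsPruningKind G S u v k) (h12 : σ.reg 12 = u) (h13 : σ.reg 13 = v)
    (h14 : σ.reg 14 = k) :
    WP X N merge (fun τ => ∃ S' C' Y' A' T', Layout n τ.mem E A' T' ∧
      Represents G (r + 1) S' C' Y' A' T' ∧ ∃ i ∈ S', τ.reg 18 + 1 = A' i) σ := by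
  have hAu := (hR.labels u).2 hu
  have hAv := (hR.labels v).2 hv
  have hAu' := hR.label_le u hu
  have hAv' := hR.label_le v hv
  have hr : r + 1 ≤ n := by
    have := hR.card
    have := Finset.card_pos.2 ⟨u, hu⟩
    omega
  have hadj : Indicates (σ.mem (u * n + v)) (G.Adj u v) := by
    rw [hL.adj _ (entry_lt u v)]
    exact hE u v
  have hk01 : k = 0 ∨ k = 1 := hk.elim (fun h => Or.inr h.1) (fun h => Or.inl h.1)
  rw [merge, wp_seq, wp_assign, wp_seq, wp_assign, wp_seq, wp_assign]
  simp only [Expr.eval_entry, Expr.eval_sub, Expr.eval_load, Expr.eval_label, Expr.eval_num,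
    State.setReg_reg, State.setReg_mem, Nat.reduceEqDiff, reduceIte, OfNat.zero_ne_ofNat,
    h0, h12, h13, hL.label u u.2, hL.label v v.2]
  refine ⟨hadj.le_one.trans (by omega), by omega, by omega, ?_⟩
  rw [wp_seq]
  refine WP.frame (wp_combine (F₁ := ClusterColoring G (C u) (Y u))
    (F₂ := ClusterColoring G (C v) (Y v)) (a := G.Adj u v) (k := k) (r := r) (s := A u - 1)
    (t := A v - 1) hL (by omega) hN (by simpa) (by simpa) (by simpa) (by simpa) (by simpa) hk01
    (by simpa using hadj) (by simp) (by simp) (by omega) (by omega) ?_ ?_ ?_) ?_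
  · exact fun f g p q hf hg hp hq => hR.table u hu f g p q (by omega) (by omega) (by omega)
      (by omega)
  · exact fun f g p q hf hg hp hq => hR.table v hv f g p q (by omega) (by omega) (by omega)
      (by omega)
  · exact hR.fresh (n + r) le_rfl
  rintro τ hτ ⟨T', hL', hT', hnew⟩
  have hτ0 : τ.reg 0 = n := by rw [hτ 0 (by decide)]; simp [h0]
  have hτ6 : τ.reg 6 = r := by rw [hτ 6 (by decide)]; simp [h6]
  have hτ12 : τ.reg 12 = u := by rw [hτ 12 (by decide)]; simp [h12]
  have hτ13 : τ.reg 13 = v := by rw [hτ 13 (by decide)]; simp [h13]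
  rw [wp_seq, wp_store, wp_seq, wp_store, wp_assign]
  simp only [Expr.eval_add, Expr.eval_label, Expr.eval_num, Expr.eval_var, State.setMem_reg,
    State.setReg_mem, hτ0, hτ6, hτ12, hτ13]
  refine ⟨by omega, by omega, by omega, S.erase v, Function.update C u (C u ∪ C v),
    Function.update Y u (Y u ∪ if k = 1 then Y v else ∅), _, T',
    (hL'.setLabel u.2 (n + r + 1)).setLabel v.2 0, ?_, u, Finset.mem_erase.2 ⟨huv, hu⟩, ?_⟩
  swap
  · have : (u : ℕ) ≠ v := Fin.val_ne_of_ne huv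
    simp [this]
  have hlab : ∀ i : Fin n, Function.update (Function.update A u (n + r + 1)) v 0 i =
      if i = v then 0 else if i = u then n + r + 1 else A i := fun i => by
    simp only [Function.update_apply, Fin.val_inj]
  refine ⟨hR.clustering.merge hu hv huv hk, ?_, ?_, ?_, ?_, ?_⟩
  · rw [Finset.card_erase_of_mem hv]
    have := hR.card
    have := Finset.card_pos.2 ⟨u, hu⟩
    omega
  · intro i
    rw [hlab, Finset.mem_erase]
    split_ifs with h1 h2
    · simp [h1]
    · simp [h2, hu, huv]
    · simpa [h1] using hR.labels i
  · intro i hi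
    obtain ⟨hiv, hi⟩ := Finset.mem_erase.1 hi
    have := hR.label_le i hi
    rw [hlab]
    split_ifs <;> omega
  · intro i hi f g p q hf hg hp hq
    obtain ⟨hiv, hi⟩ := Finset.mem_erase.1 hi
    rw [hlab, if_neg hiv]
    by_cases hiu : i = u
    · rw [if_pos hiu, hiu, Function.update_self, Function.update_self, Nat.add_sub_cancel]
      refine (hnew f g p q hf hg hp hq).congr ?_
      rw [clusterColoring_union (hR.clustering.disjoint u hu v hv huv)
        (hR.clustering.subset u hu) (hR.clustering.subset v hv)
        (hR.clustering.adj u hu v hv huv) hk01]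
      constructor
      · rintro ⟨f₁, g₁, p₁, q₁, f₂, g₂, p₂, q₂, -, h⟩
        exact ⟨f₁, g₁, p₁, q₁, f₂, g₂, p₂, q₂, h⟩
      · rintro ⟨f₁, g₁, p₁, q₁, f₂, g₂, p₂, q₂, h⟩
        refine ⟨f₁, g₁, p₁, q₁, f₂, g₂, p₂, q₂, ?_, h⟩
        have h1 := h.2.2.2.2.1.le
        have h2 := h.2.2.2.2.2.1.le
        rw [Fintype.card_fin] at h1 h2
        simp only [List.mem_cons, List.not_mem_nil, or_false, forall_eq_or_imp, forall_eq]
        omega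
    · have hAi := hR.label_le i hi
      have hAi' := (hR.labels i).2 hi
      rw [if_neg hiu, Function.update_of_ne hiu, Function.update_of_ne hiu, hT' _ (by omega)]
      exact hR.table i hi f g p q hf hg hp hq
  · intro t ht f g p q hf hg hp hq
    rw [hT' t (by omega)]
    exact hR.fresh t (by omega) f g p q hf hg hp hq

/-- One round: the pruning pair that the search finds is merged. -/
theorem wp_round {C Y : Fin n → Finset (Fin n)} {r : ℕ} (hG : IsDistanceHereditary G)
    (hL : Layout n σ.mem E A T) (hE : IsAdjMatrix G E) (hR : Represents G r S C Y A T)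
    (hX : 2 * n + 2 ≤ X) (hN : n + 1 ≤ N) (h0 : σ.reg 0 = n) (h3 : σ.reg 3 = 2 * n + 2)
    (h4 : σ.reg 4 = n + 1) (h6 : σ.reg 6 = r) (hr : r + 2 ≤ n) :
    WP X N (seq search merge) (fun τ => ∃ S' C' Y' A' T', Layout n τ.mem E A' T' ∧
      Represents G (r + 1) S' C' Y' A' T' ∧ ∃ i ∈ S', τ.reg 18 + 1 = A' i) σ := by
  rw [wp_seq]
  refine ((wp_search hL hE hR.labels (by omega) (by omega) h0
    (hG.commonNeighborOnWalks.exists_isPruningPair S (by have := hR.card; omega))).mem_eq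
      rfl).frame ?_
  rintro τ hτ ⟨hmem, u, hu, v, hv, huv, hk, h12, h13⟩
  exact wp_merge (hmem ▸ hL) hE hR hX hN (by rw [hτ 0 (by decide), h0])
    (by rw [hτ 3 (by decide), h3]) (by rw [hτ 4 (by decide), h4]) (by rw [hτ 6 (by decide), h6])
    hu hv huv hk h12 h13 rfl

end Cmd

/-! ### Correctness and running time of the algorithm -/

namespace Cmd

variable {n X N : ℕ} {G : SimpleGraph (Fin n)} {S : Finset (Fin n)} {E A : ℕ → ℕ}
  {T : ℕ → ℕ → ℕ → ℕ → ℕ → ℕ} {σ : State}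

theorem wp_setup (hL : Layout n σ.mem E 0 0) (hX : 2 * n + 2 ≤ X) (hN : n + 1 ≤ N)
    (h0 : σ.reg 0 = n) (hn : 0 < n) :
    WP X N setup (fun τ => τ.reg 0 = n ∧ τ.reg 1 = σ.reg 1 ∧ τ.reg 2 = σ.reg 2 ∧
      τ.reg 3 = 2 * n + 2 ∧ τ.reg 4 = n + 1 ∧ τ.reg 5 = n - 1 ∧
      ∃ S C Y A T, Layout n τ.mem E A T ∧ Represents G 0 S C Y A T ∧
        ∃ i ∈ S, τ.reg 18 + 1 = A i) σ := by
  rw [setup, wp_seq, wp_assign, wp_seq, wp_assign, wp_seq, wp_assign, wp_seq, wp_assign]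
  simp only [Expr.eval_add, Expr.eval_mul, Expr.eval_sub, Expr.eval_num, Expr.eval_var,
    State.setReg_reg, OfNat.zero_ne_ofNat, reduceIte, h0]
  refine ⟨hX, by omega, by omega, by omega, wp_loop (fun i τ => ∃ A T, Layout n τ.mem E A T ∧
    (∀ j, A j = if j < i then j + 1 else 0) ∧
    ∀ t f g p q, Indicates (T t f g p q) (t < i ∧ ((f = 0 ∧ g = 0 ∧ p = 0 ∧ q = 0) ∨
      (f = 1 ∧ g = 0 ∧ p = 1 ∧ q = 0) ∨ (f = 0 ∧ g = 1 ∧ p = 0 ∧ q = 1)))) ?_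
    ⟨0, 0, hL, by simp, by simp [Indicates]⟩ ?_ ?_⟩
  · simp only [State.setReg_reg, OfNat.zero_ne_ofNat, reduceIte, h0]
    omega
  · rintro i hi τ hτ ⟨A, T, hL, hA, hT⟩
    simp only [State.setReg_reg, OfNat.zero_ne_ofNat, reduceIte, h0] at hi
    have hτ0 : τ.reg 0 = n := by rw [hτ 0 (by decide)]; simp [h0]
    have hτ3 : τ.reg 3 = 2 * n + 2 := by rw [hτ 3 (by decide)]; simp
    have e : ∀ υ : State, υ.reg = (τ.setReg 7 i).reg → ∀ t f g p q : Expr,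
        (Expr.table t f g p q).eval υ =
          tableAddr n (t.eval υ) (f.eval υ) (g.eval υ) (p.eval υ) (q.eval υ) := fun υ hυ =>
      Expr.eval_table (by rw [hυ]; simp [hτ0]) (by rw [hυ]; simp [hτ3])
    rw [wp_seq, wp_store, wp_seq, wp_store, wp_seq, wp_store, wp_store,
      e ((τ.setReg 7 i).setMem _ _) rfl, e (((τ.setReg 7 i).setMem _ _).setMem _ _) rfl,
      e ((((τ.setReg 7 i).setMem _ _).setMem _ _).setMem _ _) rfl]
    simp only [Expr.eval_add, Expr.eval_label, Expr.eval_num,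
      Expr.eval_var, State.setMem_reg, State.setReg_reg, OfNat.zero_ne_ofNat, reduceIte, hτ0]
    refine ⟨by omega, by omega, by omega, by omega, _, _,
      ((((show Layout n (τ.setReg 7 i).mem E A T from hL).setLabel hi (i + 1)).setTable
        (t := i) (f := 0) (g := 0) (p := 0) (q := 0) (by omega) (by omega) (by omega) (by omega)
          1).setTable (t := i) (f := 1) (g := 0) (p := 1) (q := 0) (by omega) (by omega) (by omega)
          (by omega) 1).setTable (t := i) (f := 0) (g := 1) (p := 0) (q := 1) (by omega) (by omega)
          (by omega) (by omega) 1, ?_, ?_⟩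
    · intro j
      rw [Function.update_apply, hA]
      split_ifs <;> omega
    · intro t f g p q
      by_cases ht : t = i
      · subst ht
        have h0 := (hT t f g p q).2 (fun h => (lt_irrefl _ h.1).elim)
        simp only [h0, true_and, lt_add_iff_pos_right, zero_lt_one, Indicates]
        split_ifs <;> simp_all
      · simp only [ht, false_and, if_false]
        refine (hT t f g p q).congr (and_congr_left fun _ => ?_)
        omega
  · rintro τ hτ ⟨A, T, hL, hA, hT⟩
    simp only [State.setReg_reg, OfNat.zero_ne_ofNat, reduceIte, h0] at hA hT ⊢
    have hτ' : ∀ x, x ∉ [7, 3, 4, 5, 18] → τ.reg x = σ.reg x := fun x hx => by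
      simp only [List.mem_cons, List.not_mem_nil, or_false, not_or] at hx
      rw [hτ x (by simp [writes, hx])]
      simp [hx]
    have hτ3 : τ.reg 3 = 2 * n + 2 := by rw [hτ 3 (by decide)]; simp
    have hτ4 : τ.reg 4 = n + 1 := by rw [hτ 4 (by decide)]; simp
    have hτ5 : τ.reg 5 = n - 1 := by rw [hτ 5 (by decide)]; simp
    have hτ18 : τ.reg 18 = 0 := by rw [hτ 18 (by decide)]; simp
    simp only [Nat.reduceEqDiff, OfNat.one_ne_ofNat, reduceIte, hτ3, hτ4, hτ5, hτ18,
      hτ' 0 (by decide), hτ' 1 (by decide), hτ' 2 (by decide), h0, true_and]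
    refine ⟨Finset.univ, _, _, A, T, hL, ⟨isClustering_singletons G, by simp, ?_, ?_, ?_, ?_⟩,
      ⟨0, hn⟩, by simp, by simp [hA, hn]⟩
    · intro i
      simp [hA]
    · intro i _
      have := i.2
      simp [hA]
    · intro i _ f g p q _ _ _ _
      refine (hT _ f g p q).congr ?_
      rw [clusterColoring_singleton, hA, if_pos i.2, Nat.add_sub_cancel]
      exact and_iff_right i.2
    · intro t ht f g p q _ _ _ _
      exact (hT t f g p q).2 fun h => by omega

theorem wp_lookup {C Y : Fin n → Finset (Fin n)} {r b w : ℕ} {i : Fin n}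
    (hL : Layout n σ.mem E A T) (hR : Represents G r {i} C Y A T)
    (hX : 1 ≤ X) (hN : n + 1 ≤ N) (h0 : σ.reg 0 = n) (h1 : σ.reg 1 = b) (h2 : σ.reg 2 = w)
    (h3 : σ.reg 3 = 2 * n + 2) (h4 : σ.reg 4 = n + 1) (h18 : σ.reg 18 + 1 = A i)
    (hb : b < n + 1) (hw : w < n + 1) :
    WP X N lookup (fun τ => Answers τ (HasColoring G b w)) σ := by
  rw [lookup, wp_seq, wp_assign]
  refine ⟨by simp, ?_⟩
  rw [wp_seq]
  refine WP.mono (wp_nest [7, 8] (by decide) (by decide) (by decide) (by decide) (n + 1) hN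
    (fun D τ => (∀ x ∈ [0, 1, 2, 3, 18], τ.reg x = σ.reg x) ∧ τ.mem = σ.mem ∧
      Indicates (τ.reg 27) (∃ f g, [f, g] ∈ D ∧ ClusterColoring G (C i) (Y i) f g b w))
    ?_ ?_ ∅ _ (by simpa using h4) ⟨?_, rfl, by simp [Indicates]⟩) ?_
  · rintro D τ x v hx ⟨h1, h2, h3⟩
    have hx : x = 7 ∨ x = 8 := by simpa using hx
    simp only [List.mem_cons, List.not_mem_nil, or_false, forall_eq_or_imp, forall_eq] at h1
    rcases hx with rfl | rfl <;> simpa [h1] using ⟨h2, h3⟩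
  · rintro D τ ⟨hreg, hmem, hD⟩ hlt
    simp only [List.mem_cons, List.not_mem_nil, or_false, forall_eq_or_imp, forall_eq] at hlt
    obtain ⟨hf, hg⟩ := hlt
    obtain ⟨f, e₁⟩ : ∃ v, τ.reg 7 = v := ⟨_, rfl⟩
    obtain ⟨g, e₂⟩ : ∃ v, τ.reg 8 = v := ⟨_, rfl⟩
    rw [e₁] at hf
    rw [e₂] at hg
    have htab := hR.table i (by simp) f g b w (by omega) (by omega) (by omega) (by omega)
    rw [← h18, Nat.add_sub_cancel] at htab
    have hcond : Expr.eval τ (.num 0) <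
        Expr.eval τ (.load (.table (.var 18) (.var 7) (.var 8) (.var 1) (.var 2))) ↔
        ClusterColoring G (C i) (Y i) f g b w := by
      rw [Expr.eval_load, Expr.eval_table ((hreg 0 (by simp)).trans h0)
        ((hreg 3 (by simp)).trans h3)]
      simp only [Expr.eval_num, Expr.eval_var, e₁, e₂, (hreg 1 (by simp)).trans h1,
        (hreg 2 (by simp)).trans h2, hreg 18 (by simp), hmem]
      rw [hL.table _ _ _ _ _ (by omega) (by omega) (by omega) (by omega)]
      exact htab.pos_iff
    simp only [List.map_cons, List.map_nil, e₁, e₂]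
    rw [wp_ite, hcond]
    refine ⟨fun hc => ?_, fun hc => ?_⟩
    · rw [wp_assign]
      simp only [List.mem_cons, List.not_mem_nil, or_false, forall_eq_or_imp, forall_eq] at hreg
      refine ⟨by simpa using hX, by simpa using hreg, hmem, ?_⟩
      simp only [State.setReg_reg, reduceIte, Expr.eval_num]
      exact ⟨fun _ => rfl, fun h => absurd ⟨f, g, Set.mem_insert _ _, hc⟩ h⟩
    · rw [wp_skip]
      refine ⟨hreg, hmem, hD.congr ⟨?_, ?_⟩⟩
      · rintro ⟨f', g', h, h'⟩
        exact ⟨f', g', Set.mem_insert_of_mem _ h, h'⟩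
      · rintro ⟨f', g', h | h, h'⟩
        · simp only [List.cons.injEq, and_true] at h
          obtain ⟨rfl, rfl⟩ := h
          exact absurd h' hc
        · exact ⟨f', g', h, h'⟩
  · simp
  · rintro τ ⟨-, -, hD⟩
    have hans : Indicates (τ.reg 27) (HasColoring G b w) := by
      refine hD.congr ?_
      rw [hR.clustering.hasColoring_iff]
      refine exists_congr fun f => exists_congr fun g => and_iff_right_of_imp fun h => ?_
      have := h.le
      rw [Fintype.card_fin] at this
      simp
      omega
    rw [wp_assign]
    refine ⟨hans.le_one.trans hX, ?_⟩
    simpa [Answers, Indicates] using hans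

theorem wp_solve (hG : IsDistanceHereditary G) (b w : ℕ) (hX : 2 * n + 2 ≤ X) (hN : n + 1 ≤ N) :
    WP X N solve (fun τ => Answers τ (HasColoring G b w)) (input G b w) := by
  have h0 : (input G b w).reg 0 = n := by simp [input]
  have h1 : (input G b w).reg 1 = b := by simp [input]
  have h2 : (input G b w).reg 2 = w := by simp [input]
  have hE : IsAdjMatrix G (input G b w).mem := by
    intro i j
    have h : ((∃ i' j' : Fin n, G.Adj i' j' ∧ (i : ℕ) * n + j = i' * n + j') ↔ G.Adj i j) := by
      constructor
      · rintro ⟨i', j', hadj, he⟩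
        obtain ⟨h1, h2⟩ := (digit_inj j.2 j'.2).1 he
        rwa [Fin.ext h1, Fin.ext h2]
      · exact fun h => ⟨i, j, h, rfl⟩
    exact ⟨fun hij => if_pos (h.2 hij), fun hij => if_neg (mt h.1 hij)⟩
  have hL : Layout n (input G b w).mem (input G b w).mem 0 0 := by
    have hz : ∀ a, n * n ≤ a → (input G b w).mem a = 0 := fun a ha => by
      refine if_neg ?_
      rintro ⟨i, j, -, rfl⟩
      have := entry_lt i j
      omega
    refine ⟨fun _ _ => rfl, fun i _ => hz _ (by omega), fun t f g p q _ _ _ _ => hz _ ?_⟩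
    have := le_tableAddr n t f g p q
    omega
  rw [solve, wp_ite]
  simp only [Expr.eval_var, Expr.eval_add, Expr.eval_num, h0, h1]
  refine ⟨fun hb => ?_, fun hb => ?_⟩
  swap
  · rw [wp_assign]
    refine ⟨by simp, fun h => ?_, fun _ => by simp⟩
    have := h.le.1
    rw [Fintype.card_fin] at this
    omega
  rw [wp_ite]
  simp only [Expr.eval_var, Expr.eval_add, Expr.eval_num, h0, h2]
  refine ⟨fun hw => ?_, fun hw => ?_⟩
  swap
  · rw [wp_assign]
    refine ⟨by simp, fun h => ?_, fun _ => by simp⟩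
    have := h.le.2
    rw [Fintype.card_fin] at this
    omega
  rw [wp_ite]
  simp only [Expr.eval_var, Expr.eval_num, h0]
  refine ⟨fun hn => ?_, fun hn => ?_⟩
  swap
  · rw [wp_assign]
    refine ⟨by simpa using by omega, fun _ => by simp, fun h => absurd ?_ h⟩
    exact ⟨∅, ∅, by simp; omega⟩
  rw [wp_seq]
  refine (wp_setup (G := G) hL hX hN h0 hn).mono ?_
  rintro τ ⟨e0, e1, e2, e3, e4, e5, hI⟩
  rw [wp_seq]
  refine wp_loop (fun r τ => ∃ S C Y A T, Layout n τ.mem (input G b w).mem A T ∧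
    Represents G r S C Y A T ∧ ∃ i ∈ S, τ.reg 18 + 1 = A i) (by omega) hI ?_ ?_
  · rintro r hr υ hυ ⟨S, C, Y, A, T, hL, hR, -⟩
    rw [e5] at hr
    have hframe : ∀ x, x ∉ 6 :: (seq search merge).writes → (υ.setReg 6 r).reg x = τ.reg x :=
      fun x hx => by
        rw [State.setReg_reg, if_neg (fun h => hx (by simp [h])), hυ x hx]
    exact wp_round (σ := υ.setReg 6 r) hG hL hE hR hX hN (by rw [hframe 0 (by decide), e0])
      (by rw [hframe 3 (by decide), e3]) (by rw [hframe 4 (by decide), e4]) (by simp) (by omega)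
  · rintro υ hυ ⟨S, C, Y, A, T, hL, hR, i, hi, h18⟩
    have hcard := hR.card
    rw [e5] at hcard hR ⊢
    obtain ⟨j, rfl⟩ := Finset.card_eq_one.1 (by omega : S.card = 1)
    rw [Finset.mem_singleton] at hi
    subst hi
    have hframe : ∀ x, x ∉ 6 :: (seq search merge).writes → ∀ v, (υ.setReg 6 v).reg x = τ.reg x :=
      fun x hx v => by
        rw [State.setReg_reg, if_neg (fun h => hx (by simp [h])), hυ x hx]
    exact wp_lookup (σ := υ.setReg 6 (n - 1)) hL hR (by omega) hN
      (by rw [hframe 0 (by decide), e0]) (by rw [hframe 1 (by decide), e1, h1])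
      (by rw [hframe 2 (by decide), e2, h2]) (by rw [hframe 3 (by decide), e3])
      (by rw [hframe 4 (by decide), e4]) (by simpa using h18) hb hw

end Cmd

/-- Every loop has at most `n + 1` rounds, and loops are nested at most nine deep. -/
theorem cost_isBigO :
    (fun n : ℕ => ((Cmd.solve.compile.cost (n + 1) : ℕ) : ℝ)) =O[Filter.atTop]
      (fun n : ℕ => (n : ℝ) ^ 13) := by
  refine Asymptotics.IsBigO.of_bound ((Cmd.solve.compile.size * 2 ^ 13 : ℕ) : ℝ) ?_
  filter_upwards [Filter.eventually_ge_atTop 1] with n hn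
  rw [Real.norm_of_nonneg (by positivity), Real.norm_of_nonneg (by positivity)]
  have h : Cmd.solve.compile.cost (n + 1) ≤ Cmd.solve.compile.size * 2 ^ 13 * n ^ 13 := by
    refine (Prog.cost_le (n + 1) (by omega) _).trans ?_
    rw [mul_assoc, ← mul_pow]
    refine Nat.mul_le_mul_left _ ?_
    exact (Nat.pow_le_pow_right (by omega) (Cmd.solve_depth.trans (by omega))).trans
      (Nat.pow_le_pow_left (by omega) 13)
  exact_mod_cast h

end BWColoring

theorem mainTheorem3 :
    ∃ (c : BWColoring.Prog) (k : ℕ) (T : ℕ → ℕ),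
      (fun n : ℕ => (T n : ℝ)) =O[Filter.atTop] (fun n : ℕ => (n : ℝ) ^ 13) ∧
      ∀ (n : ℕ) (G : SimpleGraph (Fin n)), BWColoring.IsDistanceHereditary G →
        ∀ b w : ℕ, ∃ (t : ℕ) (τ : BWColoring.State),
          BWColoring.Exec ((n + b + w + 2) ^ k) c (BWColoring.input G b w) t τ ∧
          t ≤ T n ∧
          BWColoring.Answers τ (BWColoring.HasColoring G b w) := by
  -- All stored numbers are at most `(n + b + w + 2) ^ 2`, and expressions have size at most `64`.
  refine ⟨BWColoring.Cmd.solve.compile, 2 * 64, fun n => BWColoring.Cmd.solve.compile.cost (n + 1),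
    BWColoring.cost_isBigO, fun n G hG b w => ?_⟩
  have hsq : 2 * (n + b + w + 2) ≤ (n + b + w + 2) ^ 2 := by
    rw [sq]
    exact Nat.mul_le_mul_right _ (by omega)
  obtain ⟨hsafe, hans⟩ := BWColoring.Cmd.wp_solve (X := (n + b + w + 2) ^ 2) hG b w
    (by omega) le_rfl
  have hbound : (BWColoring.input G b w).BoundedBy ((n + b + w + 2) ^ 2) := by
    constructor
    · intro r _
      simp only [BWColoring.input]
      split_ifs <;> omega
    · intro a
      simp only [BWColoring.input]
      split_ifs <;> omega
  obtain ⟨t, τ, h1, h2, h3, -⟩ := BWColoring.Cmd.exec_compile (M := (n + b + w + 2) ^ (2 * 64))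
    (by omega) (by omega : 1 ≤ 64) (by rw [pow_mul]) BWColoring.Cmd.solve
    BWColoring.Cmd.solve_wf _ hsafe hbound _ ⟨rfl, fun _ _ => rfl⟩
  refine ⟨t, τ, h1, h2, ?_⟩
  rwa [BWColoring.Answers, h3.2 0 (by omega)]
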